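/- Write $\mathbb R_{\max}=\mathbb R\cup\{-\infty\}$, $\mathbb R_{\min}=\mathbb R\cup\{+\infty\}$, $\mathbb N=\{1,2,\dots\}$. A P-time event graph (P-TEG) with $n$ transitions $1,\dots,n$ and at most one initial token per place has finitely many places; each place $p$ has one upstream transition, one downstream transition, $m(p)\in\{0,1\}$ initial tokens and a time window with endpoints $\tau_p^-\in[0,\infty)$, $\tau_p^+\in[0,\infty]$. Its characteristic matrices $A^0,A^1\in\mathbb R_{\max}^{n\times n}$, $B^0,B^1\in\mathbb R_{\min}^{n\times n}$ have entries $A^\mu_{ij}=\tau^-_p$, $B^\mu_{ij}=\tau^+_p$ if $p$ is a place with $\mu$ initial tokens from transition $j$ to transition $i$, and $A^\mu_{ij}=-\infty$, $B^\mu_{ij}=+\infty$ if there is no such place (for several such places, $A^\mu_{ij}$ is the maximum of the $\tau_p^-$ and $B^\mu_{ij}$ the minimum of the $\tau_p^+$). The P-TEG is consistent under loose initial conditions if there are reals $x_i(k)$ ($1\le i\le n$, $k\in\mathbb N$; the time of the $k$-th firing of transition $i$) with $$A^\mu_{ij}+x_j(k)\le x_i(k+\mu)\le B^\mu_{ij}+x_j(k),\qquad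 x_i(k)\le x_i(k+1)\qquad\text{for all } i,j,\ \mu\in\{0,1\},\ k\in\mathbb N,$$ (equivalently, the window of every place is respected). It is consistent under strict initial conditions with initial time $t_0\in\mathbb R$ if in addition $A^1_{ij}+t_0\le x_i(1)\le B^1_{ij}+t_0$ and $t_0\le x_i(1)$ for all $i,j$. These definitions make sense for arbitrary matrices $A^0,A^1\in\mathbb R_{\max}^{n\times n}$, $B^0,B^1\in\mathbb R_{\min}^{n\times n}$. Put $L_{ij}=-B^1_{ji}$, $C_{ij}=\max\{A^0_{ij},-B^0_{ji}\}$, $R_{ij}=A^1_{ij}$ for $i\ne j$ and $R_{ii}=\max\{0,A^1_{ii}\}$. The derived $\mathbb N$-periodic graph $\mathcal G_{\mathbb N}$ has the nodes $(i,k)$, $1\le i\le n$, $k\in\mathbb N$, and an arc from $(i,k)$ to $(j,k+s)$, where $s\in\{-1,0,1\}$ and $k+s\in\mathbb N$, of weight $L_{ji}$, $C_{ji}$, $R_{ji}$ for $s=-1,0,1$ respectively, whenever this entry is not $-\infty$. The derived ultimately periodic graph $\mathcal G_{\mathrm U}$ has the nodes $(i,k)$, $k\in\mathbb Z$; its arcs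 are those defined in the same way for $k,k+s\ge 0$ and $k,k+s$ not both $0$, together with arcs of weight $0$ from $(i,0)$ to $(j,0)$ for all $i,j$. A graph contains an $\infty$-weight path if there are nodes $u,v$ and a sequence of finite paths from $u$ to $v$ whose weights tend to $+\infty$. **Theorem.** For every P-TEG with $n$ transitions and at most one initial token per place, and more generally for all matrices $A^0,A^1\in\mathbb R_{\max}^{n\times n}$, $B^0,B^1\in\mathbb R_{\min}^{n\times n}$: 1. it is consistent under loose initial conditions if and only if $\mathcal G_{\mathbb N}$ contains no $\infty$-weight path; 2. for every $t_0\in\mathbb R$, it is consistent under strict initial conditions with initial time $t_0$ if and only if $\mathcal G_{\mathrm U}$ contains no $\infty$-weight path. Moreover, given $n$ and $A^0,A^1,B^0,B^1$, consistency under loose initial conditions, and consistency under strict initial conditions, can each be decided in strongly polynomial time $O(n^5)$: in the arithmetic model of computation, where every elementary operation takes one step, there is one program for all $n$ that decides the question in $O(n^5)$ steps, using only additions, negations, maxima and comparisons of extended reals. -/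

import Mathlib

open Filter Asymptotics
open scoped NNReal

noncomputable section

namespace PTimeEventGraph

/-! ## Extended reals

`WithBot ℝ` is the set of reals together with `-∞`, and `WithTop ℝ` is the set of reals together
with `+∞`. -/

/-- Negation, from `ℝ ∪ {+∞}` to `ℝ ∪ {-∞}`. -/
def negTop : WithTop ℝ → WithBot ℝ :=
  WithTop.recTopCoe ⊥ fun a => ((-a : ℝ) : WithBot ℝ)

/-- The inclusion of `ℝ ∪ {-∞}` into the extended reals. -/
def botToEReal : WithBot ℝ → EReal :=
  WithBot.recBotCoe ⊥ fun a => (a : EReal)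

/-- The inclusion of `ℝ ∪ {+∞}` into the extended reals. -/
def topToEReal : WithTop ℝ → EReal :=
  WithTop.recTopCoe ⊤ fun a => (a : EReal)

/-! ## Weighted digraphs and `∞`-weight paths -/

/-- A weighted directed graph. The value `weight i j` is meaningful only if `(i, j)` is an arc. -/
structure WDigraph (V : Type*) where
  Arc : V → V → Prop
  weight : V → V → ℝ

namespace WDigraph

variable {V : Type*}

/-- Finite paths (of length at least one) from a node to a node. -/
inductive Path (G : WDigraph V) : V → V → Type _
  | single {i j : V} (h : G.Arc i j) : Path G i j
  | cons {i j k : V} (h : G.Arc i j) (p : Path G j k) : Path G i k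

/-- The weight of a path: the sum of the weights of its arcs. -/
def Path.weight {G : WDigraph V} : {i j : V} → G.Path i j → ℝ
  | i, j, .single _ => G.weight i j
  | i, _, .cons (j := j) _ p => G.weight i j + p.weight

/-- The graph contains an `∞`-weight path: for some nodes `i`, `j` there is a sequence of (finite)
paths from `i` to `j` whose weights tend to `+∞`. -/
def HasInftyWeightPath (G : WDigraph V) : Prop :=
  ∃ (i j : V) (p : ℕ → G.Path i j), Tendsto (fun h => (p h).weight) atTop atTop

end WDigraph

/-! ## Static, periodic and ultimately periodic graphs -/

/-- A static graph on `n` nodes: a weighted multi-digraph whose arcs `(i, s, j)` carry a shift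
`s ∈ {-1, 0, 1}`. -/
structure StaticGraph (n : ℕ) where
  Arc : Fin n → ℤ → Fin n → Prop
  weight : Fin n → ℤ → Fin n → ℝ
  shift_mem : ∀ {i s j}, Arc i s j → s = -1 ∨ s = 0 ∨ s = 1

/-- The matrix belonging to the shift `s`: `L`, `C`, `R` for `s = -1, 0, 1`. -/
def shiftMatrix {n : ℕ} (L C R : Matrix (Fin n) (Fin n) (WithBot ℝ)) (s : ℤ) :
    Matrix (Fin n) (Fin n) (WithBot ℝ) :=
  if s = -1 then L else if s = 0 then C else if s = 1 then R else fun _ _ => ⊥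

/-- The static graph of `L`, `C`, `R`: there is an arc from `i` to `j` with shift `s` if and only if
the `(j, i)` entry of the matrix of `s` is not `-∞`, and then this entry is its weight. -/
def staticGraph {n : ℕ} (L C R : Matrix (Fin n) (Fin n) (WithBot ℝ)) : StaticGraph n where
  Arc i s j := shiftMatrix L C R s j i ≠ ⊥
  weight i s j := (shiftMatrix L C R s j i).unbotD 0
  shift_mem := by
    intro i s j h
    by_contra hs
    simp only [not_or] at hs
    exact h (by simp [shiftMatrix, hs.1, hs.2.1, hs.2.2])

/-- The `S`-periodic graph induced by a static graph, for a set `S` of integers: its nodes are the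
pairs `(i, k)` with `k ∈ S`, and every arc `(i, s, j)` of the static graph induces the arcs from
`(i, k)` to `(j, k + s)`, with the same weight, for all `k` with `k, k + s ∈ S`. -/
def StaticGraph.periodicGraph {n : ℕ} (G : StaticGraph n) (S : Set ℤ) : WDigraph (Fin n × S) where
  Arc u v := G.Arc u.1 ((v.2 : ℤ) - u.2) v.1
  weight u v := G.weight u.1 ((v.2 : ℤ) - u.2) v.1

/-- The `ℕ`-periodic graph, where `ℕ` is the set of positive integers. -/
def StaticGraph.natPeriodicGraph {n : ℕ} (G : StaticGraph n) :
    WDigraph (Fin n × {k : ℤ | 0 < k}) :=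
  G.periodicGraph {k : ℤ | 0 < k}

/-- The ultimately periodic graph with negative periodic part given by `Gn`, transient part given by
the matrix `Ct`, and positive periodic part given by `Gp`. -/
def ultimatelyPeriodicGraph {n : ℕ} (Gn : StaticGraph n) (Ct : Matrix (Fin n) (Fin n) (WithBot ℝ))
    (Gp : StaticGraph n) : WDigraph (Fin n × ℤ) where
  Arc u v :=
    ((u.2 < 0 ∨ v.2 < 0) ∧ Gn.Arc u.1 (v.2 - u.2) v.1) ∨
    ((0 < u.2 ∨ 0 < v.2) ∧ Gp.Arc u.1 (v.2 - u.2) v.1) ∨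
    (u.2 = 0 ∧ v.2 = 0 ∧ Ct v.1 u.1 ≠ ⊥)
  weight u v :=
    if u.2 < 0 ∨ v.2 < 0 then Gn.weight u.1 (v.2 - u.2) v.1
    else if 0 < u.2 ∨ 0 < v.2 then Gp.weight u.1 (v.2 - u.2) v.1
    else (Ct v.1 u.1).unbotD 0

/-! ## P-time event graphs -/

/-- Characteristic matrices `A⁰, A¹` over `ℝ ∪ {-∞}` and `B⁰, B¹` over `ℝ ∪ {+∞}`; these are the
instances of the consistency problems. -/
structure CharMatrices (n : ℕ) where
  A : Fin 2 → Matrix (Fin n) (Fin n) (WithBot ℝ)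
  B : Fin 2 → Matrix (Fin n) (Fin n) (WithTop ℝ)

namespace CharMatrices

variable {n : ℕ} (I : CharMatrices n)

/-- The firing times `x i k` (the time of the `k`-th firing of the `i`-th transition, for `k ≥ 1`;
the value at `k = 0` is not used) satisfy the inequalities of the dynamics. -/
def IsTrajectory (x : Fin n → ℕ → ℝ) : Prop :=
  ∀ k : ℕ, 1 ≤ k →
    (∀ (μ : Fin 2) (i j : Fin n),
      I.A μ i j + (x j k : WithBot ℝ) ≤ (x i (k + μ) : WithBot ℝ) ∧
      (x i (k + μ) : WithTop ℝ) ≤ I.B μ i j + (x j k : WithTop ℝ)) ∧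
    ∀ i : Fin n, x i k ≤ x i (k + 1)

/-- The additional inequalities of strict initial conditions, with initial time `t₀`. -/
def StrictInitial (t₀ : ℝ) (x : Fin n → ℕ → ℝ) : Prop :=
  (∀ i j : Fin n,
    I.A 1 i j + (t₀ : WithBot ℝ) ≤ (x i 1 : WithBot ℝ) ∧
    (x i 1 : WithTop ℝ) ≤ I.B 1 i j + (t₀ : WithTop ℝ)) ∧
  ∀ i : Fin n, t₀ ≤ x i 1

/-- Consistency under loose initial conditions. -/
def ConsistentLoose : Prop :=
  ∃ x : Fin n → ℕ → ℝ, I.IsTrajectory x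

/-- Consistency under strict initial conditions, with initial time `t₀`. -/
def ConsistentStrict (t₀ : ℝ) : Prop :=
  ∃ x : Fin n → ℕ → ℝ, I.IsTrajectory x ∧ I.StrictInitial t₀ x

def L : Matrix (Fin n) (Fin n) (WithBot ℝ) :=
  fun i j => negTop (I.B 1 j i)

def C : Matrix (Fin n) (Fin n) (WithBot ℝ) :=
  fun i j => max (I.A 0 i j) (negTop (I.B 0 j i))

def R : Matrix (Fin n) (Fin n) (WithBot ℝ) :=
  fun i j => if i = j then max 0 (I.A 1 i j) else I.A 1 i j

/-- The `ℕ`-periodic graph derived from the characteristic matrices (loose initial conditions). -/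
def looseGraph : WDigraph (Fin n × {k : ℤ | 0 < k}) :=
  (staticGraph I.L I.C I.R).natPeriodicGraph

/-- The ultimately periodic graph derived from the characteristic matrices (strict initial
conditions): the negative part has no arcs, and all entries of the transient matrix are `0`. -/
def strictGraph : WDigraph (Fin n × ℤ) :=
  ultimatelyPeriodicGraph
    (staticGraph (fun _ _ => ⊥) (fun _ _ => ⊥) (fun _ _ => ⊥))
    (fun _ _ => 0)
    (staticGraph I.L I.C I.R)

end CharMatrices

/-- A P-time event graph with `n` transitions, finite set of places `P`, and at most one initial
token per place. The place `p` has upstream transition `up p`, downstream transition `down p`,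
`marking p ∈ {0, 1}` initial tokens, and the time interval from `lower p` to `upper p`, where
`upper p` may be `+∞`. -/
structure PTEG (P : Type*) (n : ℕ) where
  up : P → Fin n
  down : P → Fin n
  marking : P → Fin 2
  lower : P → ℝ≥0
  upper : P → WithTop ℝ≥0

namespace PTEG

variable {P : Type*} {n : ℕ} (N : PTEG P n)

/-- The upper end of the time interval of `p`, as an element of `ℝ ∪ {+∞}`. -/
def upperReal (p : P) : WithTop ℝ :=
  (N.upper p).map fun b : ℝ≥0 => (b : ℝ)

/-- The time window of every place is respected: if `p` has `μ` initial tokens, then the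
`(k + μ)`-th firing of the downstream transition happens at least `lower p` and at most `upper p`
time units after the `k`-th firing of the upstream transition. The firing times of each transition
are nondecreasing. The initial tokens are not constrained. -/
def IsTrajectory (x : Fin n → ℕ → ℝ) : Prop :=
  ∀ k : ℕ, 1 ≤ k →
    (∀ p : P,
      (N.lower p : ℝ) + x (N.up p) k ≤ x (N.down p) (k + N.marking p) ∧
      (x (N.down p) (k + N.marking p) : WithTop ℝ) ≤
        N.upperReal p + (x (N.up p) k : WithTop ℝ)) ∧
    ∀ i : Fin n, x i k ≤ x i (k + 1)

/-- Strict initial conditions: all initial tokens arrive in their places at time `t₀`, they have to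
respect the time windows as well, and no transition fires before `t₀`. -/
def StrictInitial (t₀ : ℝ) (x : Fin n → ℕ → ℝ) : Prop :=
  (∀ p : P, N.marking p = 1 →
    (N.lower p : ℝ) + t₀ ≤ x (N.down p) 1 ∧
    (x (N.down p) 1 : WithTop ℝ) ≤ N.upperReal p + (t₀ : WithTop ℝ)) ∧
  ∀ i : Fin n, t₀ ≤ x i 1

/-- Consistency under loose initial conditions. -/
def ConsistentLoose : Prop :=
  ∃ x : Fin n → ℕ → ℝ, N.IsTrajectory x

/-- Consistency under strict initial conditions, with initial time `t₀`. -/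
def ConsistentStrict (t₀ : ℝ) : Prop :=
  ∃ x : Fin n → ℕ → ℝ, N.IsTrajectory x ∧ N.StrictInitial t₀ x

/-- The characteristic matrices: if there is a place `p` with `μ` initial tokens, upstream
transition `j` and downstream transition `i`, then `Aᵘᵢⱼ = lower p` and `Bᵘᵢⱼ = upper p`; if there
is no such place, `Aᵘᵢⱼ = -∞` and `Bᵘᵢⱼ = +∞`. For several such places the intersection of
their time windows is taken. -/
def charMatrices [Fintype P] : CharMatrices n where
  A μ i j := (Finset.univ.filter fun p =>
      N.marking p = μ ∧ N.up p = j ∧ N.down p = i).sup fun p => ((N.lower p : ℝ) : WithBot ℝ)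
  B μ i j := (Finset.univ.filter fun p =>
      N.marking p = μ ∧ N.up p = j ∧ N.down p = i).inf fun p => N.upperReal p

end PTEG

/-! ## The arithmetic model of computation

While programs with unit cost for every elementary operation and every test. The memory has index
registers, which hold natural numbers, and two-dimensional arrays of extended reals, which are
addressed through index registers. The only operations are zero, successor, copy and comparison on
indices, and the constants `0` and `-∞`, copy, sum, negation, maximum and comparison on extended
reals, where `-∞ + a = a + -∞ = -∞` for all `a`. (So, after `t` steps on rational data, no number
has more than polynomially many bits in `t` and in the size of the data.) A program is a finite
object that does not depend on the size of the input. -/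

namespace Machine

/-- Memory: index registers, and the entry `num a i j` of the array `a` in row `i` and column `j`. -/
structure State where
  idx : ℕ → ℕ
  num : ℕ → ℕ → ℕ → EReal

/-- The operand "entry of the array `arr` whose row and column are the current contents of the index
registers `row` and `col`". -/
structure Cell where
  arr : ℕ
  row : ℕ
  col : ℕ

def State.get (s : State) (c : Cell) : EReal :=
  s.num c.arr (s.idx c.row) (s.idx c.col)

def State.setNum (s : State) (c : Cell) (v : EReal) : State where
  idx := s.idx
  num := fun a i j =>
    if a = c.arr ∧ i = s.idx c.row ∧ j = s.idx c.col then v else s.num a i j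

def State.setIdx (s : State) (r : ℕ) (v : ℕ) : State where
  idx := fun q => if q = r then v else s.idx q
  num := s.num

/-- Elementary operations; the first argument is the destination. -/
inductive Instr
  | idxZero (r : ℕ)
  | idxSucc (r : ℕ)
  | idxCopy (r q : ℕ)
  | numZero (c : Cell)
  | numBot (c : Cell)
  | numCopy (c a : Cell)
  | numNeg (c a : Cell)
  | numAdd (c a b : Cell)
  | numMax (c a b : Cell)

def Instr.run (s : State) : Instr → State
  | .idxZero r => s.setIdx r 0
  | .idxSucc r => s.setIdx r (s.idx r + 1)
  | .idxCopy r q => s.setIdx r (s.idx q)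
  | .numZero c => s.setNum c 0
  | .numBot c => s.setNum c ⊥
  | .numCopy c a => s.setNum c (s.get a)
  | .numNeg c a => s.setNum c (-s.get a)
  | .numAdd c a b => s.setNum c (s.get a + s.get b)
  | .numMax c a b => s.setNum c (max (s.get a) (s.get b))

/-- Elementary tests. -/
inductive Test
  | idxLt (r q : ℕ)
  | numLe (a b : Cell)

def Test.Holds (s : State) : Test → Prop
  | .idxLt r q => s.idx r < s.idx q
  | .numLe a b => s.get a ≤ s.get b

/-- Programs. -/
inductive Prog
  | instr (c : Instr)
  | seq (p q : Prog)
  | ite (b : Test) (p q : Prog)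
  | while (b : Test) (p : Prog)

/-- `Exec p s t s'`: started in the state `s`, the program `p` halts after exactly `t` steps in the
state `s'`. -/
inductive Exec : Prog → State → ℕ → State → Prop
  | instr (c : Instr) (s : State) : Exec (.instr c) s 1 (c.run s)
  | seq {p q : Prog} {s s' s'' : State} {t t' : ℕ} :
      Exec p s t s' → Exec q s' t' s'' → Exec (.seq p q) s (t + t') s''
  | ite_true {b : Test} {p q : Prog} {s s' : State} {t : ℕ} :
      b.Holds s → Exec p s t s' → Exec (.ite b p q) s (1 + t) s'
  | ite_false {b : Test} {p q : Prog} {s s' : State} {t : ℕ} :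
      ¬ b.Holds s → Exec q s t s' → Exec (.ite b p q) s (1 + t) s'
  | while_true {b : Test} {p : Prog} {s s' s'' : State} {t t' : ℕ} :
      b.Holds s → Exec p s t s' → Exec (.while b p) s' t' s'' →
      Exec (.while b p) s (1 + t + t') s''
  | while_false {b : Test} {p : Prog} {s : State} :
      ¬ b.Holds s → Exec (.while b p) s 1 s

/-- Execution is deterministic: final state and number of steps are determined by the program and
the initial state. -/
theorem Exec.deterministic {p : Prog} {s s₁ s₂ : State} {t₁ t₂ : ℕ}
    (h₁ : Exec p s t₁ s₁) (h₂ : Exec p s t₂ s₂) : t₁ = t₂ ∧ s₁ = s₂ := by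
  induction h₁ generalizing t₂ s₂ with
  | instr c s => cases h₂; exact ⟨rfl, rfl⟩
  | seq _ _ ih ih' =>
    cases h₂ with
    | seq k k' =>
      obtain ⟨rfl, rfl⟩ := ih k
      obtain ⟨rfl, rfl⟩ := ih' k'
      exact ⟨rfl, rfl⟩
  | ite_true hb _ ih =>
    cases h₂ with
    | ite_true _ k => obtain ⟨rfl, rfl⟩ := ih k; exact ⟨rfl, rfl⟩
    | ite_false hb' _ => exact absurd hb hb'
  | ite_false hb _ ih =>
    cases h₂ with
    | ite_true hb' _ => exact absurd hb' hb
    | ite_false _ k => obtain ⟨rfl, rfl⟩ := ih k; exact ⟨rfl, rfl⟩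
  | while_true hb _ _ ih ih' =>
    cases h₂ with
    | while_true _ k k' =>
      obtain ⟨rfl, rfl⟩ := ih k
      obtain ⟨rfl, rfl⟩ := ih' k'
      exact ⟨rfl, rfl⟩
    | while_false hb' => exact absurd hb hb'
  | while_false hb =>
    cases h₂ with
    | while_true hb' _ _ => exact absurd hb' hb
    | while_false _ => exact ⟨rfl, rfl⟩

/-- The `n × n` matrix `M`, padded with zeros. -/
def pad {n : ℕ} (M : Fin n → Fin n → EReal) (i j : ℕ) : EReal :=
  if h : i < n ∧ j < n then M ⟨i, h.1⟩ ⟨j, h.2⟩ else 0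

/-- The initial state: register `0` holds `n`, the arrays `0, 1, 2, 3` hold `A⁰, A¹, B⁰, B¹`, and
everything else is `0`. -/
def input {n : ℕ} (I : CharMatrices n) : State where
  idx := fun r => if r = 0 then n else 0
  num := fun a =>
    if a = 0 then pad fun i j => botToEReal (I.A 0 i j)
    else if a = 1 then pad fun i j => botToEReal (I.A 1 i j)
    else if a = 2 then pad fun i j => topToEReal (I.B 0 i j)
    else if a = 3 then pad fun i j => topToEReal (I.B 1 i j)
    else fun _ _ => 0

/-- On every instance with `n × n` matrices, the program `p` halts after at most `T n` steps, and
then register `0` holds `1` if the answer to the question `Q` is yes, and `0` if it is no. -/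
def DecidesInTime (p : Prog) (Q : ∀ n : ℕ, CharMatrices n → Prop) (T : ℕ → ℕ) : Prop :=
  ∀ (n : ℕ) (I : CharMatrices n), ∃ (t : ℕ) (s : State),
    Exec p (input I) t s ∧ t ≤ T n ∧ (Q n I → s.idx 0 = 1) ∧ (¬ Q n I → s.idx 0 = 0)

end Machine

end PTimeEventGraph

end

/-! Consistency is a countable system of difference inequalities with one inequality per arc of the
derived graph, so admissible firing times are potentials of that graph. A potential bounds the
weight of every path between two given nodes, which excludes `∞`-weight paths. Conversely, without
such paths the walk weights between any two nodes are bounded, and a potential is built along an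
enumeration of the nodes (`IsPartialPotential.extend`, `exists_isPotential`). Under strict initial
conditions the zero arcs at level `0` make the potential constant there, and a translation moves
this constant to `t₀`.

For the algorithm, paths are decomposed by level. Entry `(i, j)` of a matrix stands for paths from
`j` to `i`. An excursion in `P` is a concatenation of two excursions, or a step up, an excursion one
level higher and a step down; `T` collects the part before the step down. This is a weighted
context-free grammar with `4 n ^ 2` labels. Firing times bound all derivable weights
(`IsSolution.bound`). A pumping argument then shows that derivations without repeated labels on a
branch suffice (`DerSize.avoid_or_context`). Their depth is at most `4 n ^ 2`, so this many sweeps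
over all rule instances, of cost `O(n ^ 3)` each, yield a family closed under the rules.

Conversely, if the computed family is closed, then the max-plus recursion `X (k + 1) = P (R (X k))`
produces firing times (`exists_isSolution`). Hence loose consistency is equivalent to closedness
after the sweeps. Strict consistency also requires that all entries of the max-plus product of `L`
and `T` be nonpositive, which makes a constant vector at level `0` admissible. -/

noncomputable section

namespace PTimeEventGraph

/-! ## Potentials of weighted digraphs -/

namespace WDigraph

variable {V : Type*} {G : WDigraph V}

/-- Concatenation of paths. -/
def Path.append : {i j k : V} → G.Path i j → G.Path j k → G.Path i k
  | _, _, _, .single h, q => .cons h q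
  | _, _, _, .cons h p, q => .cons h (p.append q)

theorem Path.weight_append {i j k : V} (p : G.Path i j) (q : G.Path j k) :
    (p.append q).weight = p.weight + q.weight := by
  induction p with
  | single h => rfl
  | cons h p ih => simp only [Path.append, Path.weight, ih, add_assoc]

/-- A potential: a solution of the system of difference inequalities given by the arcs. -/
def IsPotential (G : WDigraph V) (φ : V → ℝ) : Prop :=
  ∀ u v, G.Arc u v → φ u + G.weight u v ≤ φ v

theorem IsPotential.le_of_path {φ : V → ℝ} (hφ : G.IsPotential φ) {u v : V} (p : G.Path u v) :
    φ u + p.weight ≤ φ v := by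
  induction p with
  | single h => exact hφ _ _ h
  | cons h p ih =>
    have := hφ _ _ h
    simp only [Path.weight]
    linarith

theorem IsPotential.not_hasInftyWeightPath {φ : V → ℝ} (hφ : G.IsPotential φ) :
    ¬ G.HasInftyWeightPath := by
  rintro ⟨u, v, p, hp⟩
  obtain ⟨h, hh⟩ := (hp.eventually_gt_atTop (φ v - φ u)).exists
  have := hφ.le_of_path (p h)
  linarith

/-- The weights of the paths from `u` to `v`, including the empty path. -/
inductive HasWalk (G : WDigraph V) : V → V → ℝ → Prop
  | refl (u : V) : HasWalk G u u 0
  | path {u v : V} (p : G.Path u v) : HasWalk G u v p.weight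

theorem HasWalk.trans {u v w : V} {a b : ℝ} (h : G.HasWalk u v a) (h' : G.HasWalk v w b) :
    G.HasWalk u w (a + b) := by
  cases h with
  | refl => simpa using h'
  | path p =>
    cases h' with
    | refl => simpa using HasWalk.path p
    | path q => rw [← Path.weight_append]; exact .path _

theorem HasWalk.iterate {u : V} {a : ℝ} (h : G.HasWalk u u a) (m : ℕ) :
    G.HasWalk u u (m * a) := by
  induction m with
  | zero => simpa using HasWalk.refl u
  | succ m ih =>
    have := ih.trans h
    rwa [show ((m + 1 : ℕ) : ℝ) * a = m * a + a by push_cast; ring]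

/-- If the weights were unbounded, walks heavier than each natural number would form an `∞`-weight
path. The empty walk is never among them, since its weight is `0`. -/
theorem exists_bound_of_not_hasInftyWeightPath (hG : ¬ G.HasInftyWeightPath) (u v : V) :
    ∃ b : ℝ, ∀ a, G.HasWalk u v a → a ≤ b := by
  by_contra! hb
  refine hG ⟨u, v, ?_⟩
  have hp : ∀ h : ℕ, ∃ p : G.Path u v, (h : ℝ) ≤ p.weight := by
    intro h
    obtain ⟨a, ha, hlt⟩ := hb h
    cases ha with
    | refl => exact absurd hlt (not_lt.2 h.cast_nonneg)
    | path p => exact ⟨p, hlt.le⟩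
  choose p hp using hp
  exact ⟨p, tendsto_atTop_mono hp tendsto_natCast_atTop_atTop⟩

/-- Repeating a closed walk of positive weight would give unbounded weights. -/
theorem HasWalk.nonpos (hG : ¬ G.HasInftyWeightPath) {u : V} {a : ℝ} (h : G.HasWalk u u a) :
    a ≤ 0 := by
  by_contra! ha
  obtain ⟨b, hb⟩ := exists_bound_of_not_hasInftyWeightPath hG u u
  obtain ⟨m, hm⟩ := exists_nat_gt (b / a)
  have := hb _ (h.iterate m)
  rw [div_lt_iff₀ ha] at hm
  linarith

/-! ### Construction of a potential node by node -/

/-- `y` is a potential for all walks between the first `m` nodes of the enumeration `f`. -/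
def IsPartialPotential (G : WDigraph V) (f : ℕ → V) (m : ℕ) (y : ℕ → ℝ) : Prop :=
  ∀ a < m, ∀ b < m, ∀ w, G.HasWalk (f a) (f b) w → y a + w ≤ y b

theorem exists_between_of_bounded {A B : Set ℝ} (hA : BddAbove A) (hB : BddBelow B)
    (h : ∀ a ∈ A, ∀ b ∈ B, a ≤ b) : ∃ z, (∀ a ∈ A, a ≤ z) ∧ ∀ b ∈ B, z ≤ b := by
  -- For empty `A` the value `sSup A = 0` is meaningless, so a lower bound of `B` is taken instead.
  rcases A.eq_empty_or_nonempty with rfl | hne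
  · obtain ⟨z, hz⟩ := hB
    exact ⟨z, by simp, fun b hb => hz hb⟩
  · exact ⟨sSup A, fun a ha => le_csSup hA ha,
      fun b hb => csSup_le hne fun a ha => h a ha b hb⟩

/-- A walk into the new node followed by a walk out of it joins two old nodes. As the partial
potential respects walks through the whole graph, the lower bounds on the new value do not exceed
the upper bounds. There are finitely many old nodes and bounded weights for each, so both families
are bounded. -/
theorem IsPartialPotential.extend (hG : ¬ G.HasInftyWeightPath) {f : ℕ → V} {m : ℕ} {y : ℕ → ℝ}
    (hy : G.IsPartialPotential f m y) :
    ∃ z, G.IsPartialPotential f (m + 1) (Function.update y m z) := by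
  choose b hb using exists_bound_of_not_hasInftyWeightPath hG
  obtain ⟨z, hlo, hhi⟩ := exists_between_of_bounded
    (A := ⋃ a ∈ Set.Iio m, {r | ∃ w, G.HasWalk (f a) (f m) w ∧ r = y a + w})
    (B := ⋃ a ∈ Set.Iio m, {r | ∃ w, G.HasWalk (f m) (f a) w ∧ r = y a - w})
    ((Set.finite_Iio m).bddAbove_biUnion.2 fun a _ =>
      ⟨y a + b (f a) (f m), by rintro _ ⟨w, hw, rfl⟩; linarith [hb _ _ _ hw]⟩)
    ((Set.finite_Iio m).bddBelow_biUnion.2 fun a _ =>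
      ⟨y a - b (f m) (f a), by rintro _ ⟨w, hw, rfl⟩; linarith [hb _ _ _ hw]⟩)
    (by
      simp only [Set.mem_iUnion, Set.mem_ofPred_eq]
      rintro _ ⟨a, ha, w, hw, rfl⟩ _ ⟨c, hc, w', hw', rfl⟩
      linarith [hy a ha c hc _ (hw.trans hw')])
  simp only [Set.mem_iUnion, Set.mem_ofPred_eq] at hlo hhi
  refine ⟨z, fun a ha c hc w hw => ?_⟩
  rcases Nat.lt_succ_iff_lt_or_eq.1 ha with ha | rfl <;>
    rcases Nat.lt_succ_iff_lt_or_eq.1 hc with hc | rfl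
  · rw [Function.update_of_ne ha.ne, Function.update_of_ne hc.ne]
    exact hy a ha c hc w hw
  · rw [Function.update_of_ne ha.ne, Function.update_self]
    exact hlo _ ⟨a, ha, w, hw, rfl⟩
  · rw [Function.update_of_ne hc.ne, Function.update_self]
    linarith [hhi _ ⟨c, hc, w, hw, rfl⟩]
  · linarith [hw.nonpos hG]

/-- The value at index `a` is settled from stage `a + 1` on, so the stages have a pointwise limit.
No connectedness is needed, in contrast to potentials defined as heaviest walks from a source. -/
theorem exists_isPotential [Countable V] (hG : ¬ G.HasInftyWeightPath) :
    ∃ φ, G.IsPotential φ := by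
  rcases isEmpty_or_nonempty V with hV | hV
  · exact ⟨fun _ => 0, fun u => isEmptyElim u⟩
  obtain ⟨f, hf⟩ := exists_surjective_nat V
  choose z hz using fun (m : ℕ) (y : {y // G.IsPartialPotential f m y}) => y.2.extend hG
  let Y : ∀ m, {y // G.IsPartialPotential f m y} := fun m =>
    Nat.rec ⟨fun _ => 0, fun a ha => absurd ha a.not_lt_zero⟩
      (fun m y => ⟨Function.update y.1 m (z m y), hz m y⟩) m
  have hY : ∀ a m, (Y (a + 1 + m)).1 a = (Y (a + 1)).1 a := by
    intro a m
    induction m with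
    | zero => rfl
    | succ m ih =>
      rw [← ih]
      exact Function.update_of_ne (ne_of_lt (by lia)) _ _
  have key : ∀ a b w, G.HasWalk (f a) (f b) w → (Y (a + 1)).1 a + w ≤ (Y (b + 1)).1 b := by
    intro a b w hw
    have := (Y (a + 1 + (b + 1))).2 a (by omega) b (by omega) w hw
    rwa [hY, add_comm (a + 1), hY] at this
  choose g hg using hf
  refine ⟨fun v => (Y (g v + 1)).1 (g v), fun u v h => key _ _ _ ?_⟩
  rw [hg, hg]
  exact .path (.single h)

theorem not_hasInftyWeightPath_iff [Countable V] :
    ¬ G.HasInftyWeightPath ↔ ∃ φ, G.IsPotential φ :=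
  ⟨exists_isPotential, fun ⟨_, h⟩ => h.not_hasInftyWeightPath⟩

end WDigraph

/-! ## Difference inequalities over the extended reals -/

theorem withBot_add_coe_le_coe {a : WithBot ℝ} {x y : ℝ} :
    a + (x : WithBot ℝ) ≤ (y : WithBot ℝ) ↔ a ≤ ((y - x : ℝ) : WithBot ℝ) := by
  induction a using WithBot.recBotCoe with
  | bot => simp
  | coe a => rw [← WithBot.coe_add, WithBot.coe_le_coe, WithBot.coe_le_coe, le_sub_iff_add_le]

theorem coe_le_withTop_add_coe {b : WithTop ℝ} {x y : ℝ} :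
    (y : WithTop ℝ) ≤ b + (x : WithTop ℝ) ↔ ((y - x : ℝ) : WithTop ℝ) ≤ b := by
  induction b using WithTop.recTopCoe with
  | top => simp
  | coe b => rw [← WithTop.coe_add, WithTop.coe_le_coe, WithTop.coe_le_coe, sub_le_iff_le_add]

theorem negTop_le_coe {b : WithTop ℝ} {r : ℝ} :
    negTop b ≤ (r : WithBot ℝ) ↔ ((-r : ℝ) : WithTop ℝ) ≤ b := by
  induction b using WithTop.recTopCoe with
  | top => simp [negTop]
  | coe b =>
    change ((-b : ℝ) : WithBot ℝ) ≤ _ ↔ _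
    rw [WithBot.coe_le_coe, WithTop.coe_le_coe, neg_le]

theorem coe_le_withTop_add_coe_iff_negTop {b : WithTop ℝ} {x y : ℝ} :
    (y : WithTop ℝ) ≤ b + (x : WithTop ℝ) ↔ negTop b ≤ ((x - y : ℝ) : WithBot ℝ) := by
  rw [coe_le_withTop_add_coe, negTop_le_coe, neg_sub]

theorem withBot_le_coe_iff {a : WithBot ℝ} {r : ℝ} :
    a ≤ (r : WithBot ℝ) ↔ (a ≠ ⊥ → a.unbotD 0 ≤ r) := by
  induction a using WithBot.recBotCoe with
  | bot => simp
  | coe a => simp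

/-! ## Consistency as a system of difference inequalities -/

namespace CharMatrices

variable {n : ℕ} (I : CharMatrices n)

/-- The inequalities between firing times in terms of `L`, `C`, `R`, those of `L` and `R` from the
index `k₀` on. -/
def IsSolution (k₀ : ℕ) (x : Fin n → ℕ → ℝ) : Prop :=
  (∀ k, 1 ≤ k → ∀ i j, I.C i j ≤ ((x i k - x j k : ℝ) : WithBot ℝ)) ∧
  (∀ k, k₀ ≤ k → ∀ i j, I.R i j ≤ ((x i (k + 1) - x j k : ℝ) : WithBot ℝ)) ∧
  ∀ k, k₀ ≤ k → ∀ i j, I.L i j ≤ ((x i k - x j (k + 1) : ℝ) : WithBot ℝ)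

/-- The `0` on the diagonal of `R` encodes that firing times are nondecreasing. -/
theorem R_le_iff {y x : Fin n → ℝ} :
    (∀ i j, I.R i j ≤ ((y i - x j : ℝ) : WithBot ℝ)) ↔
      (∀ i j, I.A 1 i j ≤ ((y i - x j : ℝ) : WithBot ℝ)) ∧ ∀ i, x i ≤ y i := by
  constructor
  · refine fun h => ⟨fun i j => le_trans ?_ (h i j), fun i => ?_⟩
    · unfold R; split_ifs <;> simp
    · have := h i i
      simp only [R, if_true, max_le_iff] at this
      have h0 := this.1
      rw [← WithBot.coe_zero, WithBot.coe_le_coe] at h0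
      linarith
  · rintro ⟨hA, hx⟩ i j
    unfold R
    split_ifs with hij
    · subst hij
      refine max_le ?_ (hA i i)
      rw [← WithBot.coe_zero, WithBot.coe_le_coe]
      linarith [hx i]
    · exact hA i j

theorem isTrajectory_iff {x : Fin n → ℕ → ℝ} : I.IsTrajectory x ↔ I.IsSolution 1 x := by
  have hR := fun k => I.R_le_iff (y := fun i => x i (k + 1)) (x := fun i => x i k)
  simp only [IsSolution, C, L, max_le_iff, hR, IsTrajectory, Fin.forall_fin_two,
    withBot_add_coe_le_coe, coe_le_withTop_add_coe_iff_negTop, Fin.val_zero, Fin.val_one, add_zero]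
  constructor
  · intro h
    exact ⟨fun k hk i j => ⟨((h k hk).1.1 i j).1, ((h k hk).1.1 j i).2⟩,
      fun k hk => ⟨fun i j => ((h k hk).1.2 i j).1, (h k hk).2⟩,
      fun k hk i j => ((h k hk).1.2 j i).2⟩
  · rintro ⟨h1, h2, h3⟩ k hk
    exact ⟨⟨fun i j => ⟨(h1 k hk i j).1, (h1 k hk j i).2⟩,
      fun i j => ⟨(h2 k hk).1 i j, h3 k hk j i⟩⟩, (h2 k hk).2⟩

theorem strictInitial_iff {t₀ : ℝ} {x : Fin n → ℕ → ℝ} :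
    I.StrictInitial t₀ x ↔ (∀ i j, I.R i j ≤ ((x i 1 - t₀ : ℝ) : WithBot ℝ)) ∧
      ∀ i j, I.L i j ≤ ((t₀ - x j 1 : ℝ) : WithBot ℝ) := by
  have hR := I.R_le_iff (y := fun i => x i 1) (x := fun _ => t₀)
  simp only [hR, StrictInitial, L, withBot_add_coe_le_coe, coe_le_withTop_add_coe_iff_negTop]
  exact ⟨fun h => ⟨⟨fun i j => (h.1 i j).1, h.2⟩, fun i j => (h.1 j i).2⟩,
    fun h => ⟨fun i j => ⟨h.1.1 i j, h.2 j i⟩, h.1.2⟩⟩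

theorem consistentLoose_iff : I.ConsistentLoose ↔ ∃ x, I.IsSolution 1 x := by
  simp only [ConsistentLoose, isTrajectory_iff]

/-- The initial time acts as a fictitious zeroth firing of all transitions. It is subject to `L` and
`R` but not to `C`, which would constrain the constant vector. -/
theorem consistentStrict_iff {t₀ : ℝ} :
    I.ConsistentStrict t₀ ↔ ∃ x, I.IsSolution 0 x ∧ ∀ i, x i 0 = t₀ := by
  simp only [ConsistentStrict, isTrajectory_iff, strictInitial_iff]
  constructor
  · rintro ⟨x, ⟨hC, hR, hL⟩, hR0, hL0⟩
    refine ⟨fun i k => if k = 0 then t₀ else x i k, ⟨fun k hk i j => ?_, fun k _ i j => ?_,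
      fun k _ i j => ?_⟩, fun i => if_pos rfl⟩
    · simpa [Nat.one_le_iff_ne_zero.1 hk] using hC k hk i j
    · rcases k.eq_zero_or_pos with rfl | hk
      · simpa using hR0 i j
      · simpa [hk.ne'] using hR k hk i j
    · rcases k.eq_zero_or_pos with rfl | hk
      · simpa using hL0 i j
      · simpa [hk.ne'] using hL k hk i j
  · rintro ⟨x, ⟨hC, hR, hL⟩, h0⟩
    refine ⟨x, ⟨hC, fun k _ => hR k k.zero_le, fun k _ => hL k k.zero_le⟩, fun i j => ?_,
      fun i j => ?_⟩
    · simpa [h0] using hR 0 le_rfl i j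
    · simpa [h0] using hL 0 le_rfl i j

/-! ## Consistency and `∞`-weight paths -/

section shiftMatrix

variable {L C R : Matrix (Fin n) (Fin n) (WithBot ℝ)}

theorem shiftMatrix_neg_one : shiftMatrix L C R (-1) = L := if_pos rfl

theorem shiftMatrix_zero : shiftMatrix L C R 0 = C := by simp [shiftMatrix]

theorem shiftMatrix_one : shiftMatrix L C R 1 = R := by
  simp [shiftMatrix]

theorem shiftMatrix_bot (s : ℤ) (i j : Fin n) :
    shiftMatrix (fun _ _ => ⊥ : Matrix (Fin n) (Fin n) (WithBot ℝ)) (fun _ _ => ⊥) (fun _ _ => ⊥) s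
      i j = ⊥ := by
  by_contra h
  rcases (staticGraph _ _ _).shift_mem h with rfl | rfl | rfl
  · exact h (congrFun₂ shiftMatrix_neg_one i j)
  · exact h (congrFun₂ shiftMatrix_zero i j)
  · exact h (congrFun₂ shiftMatrix_one i j)

end shiftMatrix

theorem consistentLoose_iff_not_hasInftyWeightPath :
    I.ConsistentLoose ↔ ¬ I.looseGraph.HasInftyWeightPath := by
  rw [WDigraph.not_hasInftyWeightPath_iff, consistentLoose_iff]
  constructor
  · rintro ⟨x, hC, hR, hL⟩
    refine ⟨fun u => x u.1 (u.2 : ℤ).toNat, ?_⟩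
    rintro ⟨i, k, hk⟩ ⟨j, l, hl⟩ h
    obtain ⟨k, rfl⟩ := Int.eq_ofNat_of_zero_le (le_of_lt hk)
    obtain ⟨l, rfl⟩ := Int.eq_ofNat_of_zero_le (le_of_lt hl)
    change shiftMatrix I.L I.C I.R ((l : ℤ) - k) j i ≠ ⊥ at h
    change x i (k : ℤ).toNat + (shiftMatrix I.L I.C I.R ((l : ℤ) - k) j i).unbotD 0 ≤
      x j (l : ℤ).toNat
    simp only [Set.mem_ofPred_eq, Nat.cast_pos] at hk hl
    rw [Int.toNat_natCast, Int.toNat_natCast]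
    rcases (staticGraph I.L I.C I.R).shift_mem h with hs | hs | hs
    · obtain rfl : k = l + 1 := by omega
      rw [hs, shiftMatrix_neg_one] at h ⊢
      have := withBot_le_coe_iff.1 (hL l hl j i) h
      linarith
    · obtain rfl : k = l := by omega
      rw [hs, shiftMatrix_zero] at h ⊢
      have := withBot_le_coe_iff.1 (hC k hk j i) h
      linarith
    · obtain rfl : l = k + 1 := by omega
      rw [hs, shiftMatrix_one] at h ⊢
      have := withBot_le_coe_iff.1 (hR k hk j i) h
      linarith
  · rintro ⟨φ, hφ⟩
    have hmem : ∀ {k : ℕ}, 0 < k → (k : ℤ) ∈ {k : ℤ | 0 < k} := fun hk => Int.natCast_pos.2 hk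
    have key : ∀ (k l : ℕ) (hk : 0 < k) (hl : 0 < l) (i j : Fin n),
        shiftMatrix I.L I.C I.R ((l : ℤ) - k) i j ≤
          ((φ (i, ⟨l, hmem hl⟩) - φ (j, ⟨k, hmem hk⟩) : ℝ) : WithBot ℝ) := by
      intro k l hk hl i j
      refine withBot_le_coe_iff.2 fun h => ?_
      have := hφ (j, ⟨k, hmem hk⟩) (i, ⟨l, hmem hl⟩) h
      simp only [looseGraph, StaticGraph.natPeriodicGraph, StaticGraph.periodicGraph,
        staticGraph] at this
      linarith
    refine ⟨fun i k => if hk : 0 < k then φ (i, ⟨k, hmem hk⟩) else 0,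
      fun k hk i j => ?_, fun k hk i j => ?_, fun k hk i j => ?_⟩
    · have := key k k hk hk i j
      simpa [shiftMatrix, Nat.pos_iff_ne_zero.1 hk, Nat.pos_of_ne_zero] using this
    · have := key k (k + 1) hk k.succ_pos i j
      simpa [shiftMatrix, Nat.pos_iff_ne_zero.1 hk, Nat.pos_of_ne_zero] using this
    · have := key (k + 1) k k.succ_pos hk i j
      simpa [shiftMatrix, Nat.pos_iff_ne_zero.1 hk, Nat.pos_of_ne_zero] using this

/-- Levels below `0` have no arcs, so any values may be given to them; `toNat` repeats those of
level `0`. -/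
theorem consistentStrict_iff_not_hasInftyWeightPath (t₀ : ℝ) :
    I.ConsistentStrict t₀ ↔ ¬ I.strictGraph.HasInftyWeightPath := by
  rw [WDigraph.not_hasInftyWeightPath_iff, consistentStrict_iff]
  constructor
  · rintro ⟨x, ⟨hC, hR, hL⟩, h0⟩
    refine ⟨fun u => x u.1 u.2.toNat, ?_⟩
    rintro ⟨i, k⟩ ⟨j, l⟩ (⟨_, h⟩ | ⟨hpos, h⟩ | ⟨rfl, rfl, h⟩)
    · exact absurd (shiftMatrix_bot _ _ _) h
    · have hs := (staticGraph I.L I.C I.R).shift_mem h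
      simp only at hpos hs h
      -- One of the two levels is positive and they differ by at most `1`, so neither is negative.
      obtain ⟨k, rfl⟩ := Int.eq_ofNat_of_zero_le (show 0 ≤ k by omega)
      obtain ⟨l, rfl⟩ := Int.eq_ofNat_of_zero_le (show 0 ≤ l by omega)
      change shiftMatrix I.L I.C I.R ((l : ℤ) - k) j i ≠ ⊥ at h
      have hw : I.strictGraph.weight (i, (k : ℤ)) (j, (l : ℤ)) =
          (shiftMatrix I.L I.C I.R ((l : ℤ) - k) j i).unbotD 0 := by
        simp only [strictGraph, ultimatelyPeriodicGraph]
        rw [if_neg (by omega), if_pos hpos]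
        rfl
      simp only [hw, Int.toNat_natCast]
      rcases hs with hs | hs | hs
      · obtain rfl : k = l + 1 := by omega
        rw [hs, shiftMatrix_neg_one] at h ⊢
        have := withBot_le_coe_iff.1 (hL l l.zero_le j i) h
        linarith
      · obtain rfl : k = l := by omega
        rw [hs, shiftMatrix_zero] at h ⊢
        have := withBot_le_coe_iff.1 (hC k (by omega) j i) h
        linarith
      · obtain rfl : l = k + 1 := by omega
        rw [hs, shiftMatrix_one] at h ⊢
        have := withBot_le_coe_iff.1 (hR k k.zero_le j i) h
        linarith
    · simp [strictGraph, ultimatelyPeriodicGraph, h0]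
  · rintro ⟨φ, hφ⟩
    have h0 : ∀ i j, φ (i, 0) = φ (j, 0) := by
      have hle : ∀ i j, φ (i, 0) ≤ φ (j, 0) := by
        intro i j
        have := hφ (i, 0) (j, 0) (Or.inr (Or.inr ⟨rfl, rfl, by simp⟩))
        simpa [strictGraph, ultimatelyPeriodicGraph] using this
      exact fun i j => le_antisymm (hle i j) (hle j i)
    obtain ⟨c, hc⟩ : ∃ c, ∀ i, φ (i, 0) = c := by
      rcases isEmpty_or_nonempty (Fin n) with hn | ⟨⟨i⟩⟩
      · exact ⟨0, fun i => isEmptyElim i⟩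
      · exact ⟨φ (i, 0), fun j => h0 j i⟩
    have key : ∀ (k l : ℕ) (i j : Fin n), 0 < k ∨ 0 < l →
        shiftMatrix I.L I.C I.R ((l : ℤ) - k) i j ≤
          ((φ (i, (l : ℤ)) - φ (j, (k : ℤ)) : ℝ) : WithBot ℝ) := by
      intro k l i j hkl
      refine withBot_le_coe_iff.2 fun h => ?_
      have hkl' : 0 < (k : ℤ) ∨ 0 < (l : ℤ) := by omega
      have := hφ (j, (k : ℤ)) (i, (l : ℤ)) (Or.inr (Or.inl ⟨hkl', h⟩))
      simp only [strictGraph, ultimatelyPeriodicGraph] at this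
      rw [if_neg (by omega), if_pos hkl'] at this
      simp only [staticGraph] at this
      linarith
    -- Difference inequalities are invariant under translation, so the common value `c` at level `0`
    -- can be moved to `t₀`.
    refine ⟨fun i k => φ (i, (k : ℤ)) - c + t₀, ⟨fun k hk i j => ?_, fun k hk i j => ?_,
      fun k hk i j => ?_⟩, fun i => by simp [hc]⟩
    · have := key k k i j (Or.inl hk)
      simpa [shiftMatrix] using this
    · have := key k (k + 1) i j (Or.inr k.succ_pos)
      simpa [shiftMatrix] using this
    · have := key (k + 1) k i j (Or.inl k.succ_pos)
      simpa [shiftMatrix] using this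

end CharMatrices

/-! ## The characteristic matrices of a P-time event graph -/

namespace PTEG

variable {P : Type*} {n : ℕ} [Fintype P] (N : PTEG P n)

theorem charMatrices_A_le_iff {μ : Fin 2} {i j : Fin n} {r : ℝ} :
    N.charMatrices.A μ i j ≤ (r : WithBot ℝ) ↔
      ∀ p, N.marking p = μ → N.up p = j → N.down p = i → (N.lower p : ℝ) ≤ r := by
  simp [charMatrices, Finset.sup_le_iff]

theorem le_charMatrices_B_iff {μ : Fin 2} {i j : Fin n} {r : ℝ} :
    (r : WithTop ℝ) ≤ N.charMatrices.B μ i j ↔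
      ∀ p, N.marking p = μ → N.up p = j → N.down p = i → (r : WithTop ℝ) ≤ N.upperReal p := by
  simp [charMatrices, Finset.le_inf_iff]

theorem isTrajectory_charMatrices_iff {x : Fin n → ℕ → ℝ} :
    N.charMatrices.IsTrajectory x ↔ N.IsTrajectory x := by
  refine forall₂_congr fun k _ => and_congr_left fun _ => ?_
  simp only [withBot_add_coe_le_coe, coe_le_withTop_add_coe, charMatrices_A_le_iff,
    le_charMatrices_B_iff, ← le_sub_iff_add_le]
  constructor
  · exact fun h p => ⟨(h _ _ _).1 p rfl rfl rfl, (h _ _ _).2 p rfl rfl rfl⟩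
  · intro h μ i j
    exact ⟨by rintro p rfl rfl rfl; exact (h p).1, by rintro p rfl rfl rfl; exact (h p).2⟩

theorem strictInitial_charMatrices_iff {t₀ : ℝ} {x : Fin n → ℕ → ℝ} :
    N.charMatrices.StrictInitial t₀ x ↔ N.StrictInitial t₀ x := by
  refine and_congr_left fun _ => ?_
  simp only [withBot_add_coe_le_coe, coe_le_withTop_add_coe, charMatrices_A_le_iff,
    le_charMatrices_B_iff, ← le_sub_iff_add_le]
  constructor
  · exact fun h p hp => ⟨(h _ _).1 p hp rfl rfl, (h _ _).2 p hp rfl rfl⟩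
  · intro h i j
    exact ⟨by rintro p hp rfl rfl; exact (h p hp).1, by rintro p hp rfl rfl; exact (h p hp).2⟩

theorem consistentLoose_charMatrices_iff :
    N.charMatrices.ConsistentLoose ↔ N.ConsistentLoose := by
  simp only [ConsistentLoose, CharMatrices.ConsistentLoose, isTrajectory_charMatrices_iff]

theorem consistentStrict_charMatrices_iff {t₀ : ℝ} :
    N.charMatrices.ConsistentStrict t₀ ↔ N.ConsistentStrict t₀ := by
  simp only [ConsistentStrict, CharMatrices.ConsistentStrict, isTrajectory_charMatrices_iff,
    strictInitial_charMatrices_iff]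

end PTEG

/-! ## Weighted binary grammars

The labels of a grammar have initial weights, and a rule `v → u u'` adds the weights of `u` and `u'`.
If the derivable weights of every label are bounded, then derivations whose depth is the number of
labels suffice to attain all of them. -/

/-- A weighted binary grammar. -/
structure Grammar (V : Type*) where
  Init : V → EReal → Prop
  Rule : V → V → V → Prop

namespace Grammar

variable {V : Type*} (Γ : Grammar V)

/-- `Der v w`: the weight `w` is derivable from the label `v`. -/
inductive Der : V → EReal → Prop
  | init {v : V} {w : EReal} : Γ.Init v w → Der v w
  | rule {v u u' : V} {a b : EReal} : Γ.Rule v u u' → Der u a → Der u' b → Der v (a + b)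

/-- Derivations with at most `m` applications of rules. -/
inductive DerSize : ℕ → V → EReal → Prop
  | init {m : ℕ} {v : V} {w : EReal} : Γ.Init v w → DerSize m v w
  | rule {m m' : ℕ} {v u u' : V} {a b : EReal} :
      Γ.Rule v u u' → DerSize m u a → DerSize m' u' b → DerSize (m + m' + 1) v (a + b)

/-- Derivations in which no label is expanded twice on a branch, and labels in `S` are not
expanded. -/
inductive DerAvoid [DecidableEq V] : Finset V → V → EReal → Prop
  | init {S : Finset V} {v : V} {w : EReal} : Γ.Init v w → DerAvoid S v w
  | rule {S : Finset V} {v u u' : V} {a b : EReal} : v ∉ S → Γ.Rule v u u' →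
      DerAvoid (insert v S) u a → DerAvoid (insert v S) u' b → DerAvoid S v (a + b)

/-- Derivable weights of `u` yield derivable weights of `v` by adding `c`. -/
def Context (v u : V) (c : EReal) : Prop :=
  ∀ w, Γ.Der u w → Γ.Der v (w + c)

variable {Γ}

theorem Der.exists_size {v : V} {w : EReal} (h : Γ.Der v w) : ∃ m, Γ.DerSize m v w := by
  induction h with
  | init h => exact ⟨0, .init h⟩
  | rule hr _ _ ih ih' =>
    obtain ⟨m, hm⟩ := ih
    obtain ⟨m', hm'⟩ := ih'
    exact ⟨_, .rule hr hm hm'⟩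

theorem DerSize.der {m : ℕ} {v : V} {w : EReal} (h : Γ.DerSize m v w) : Γ.Der v w := by
  induction h with
  | init h => exact .init h
  | rule hr _ _ ih ih' => exact .rule hr ih ih'

/-- A context is a derivation tree with one hole. Since addition is commutative, the position of the
hole is irrelevant and the sibling subtree only adds its weight to the constant. -/
theorem Context.left {v u u' t : V} {b c : EReal} (hr : Γ.Rule v u u') (hc : Γ.Context u t c)
    (hb : Γ.Der u' b) : Γ.Context v t (c + b) := fun w hw => by
  rw [← add_assoc]
  exact .rule hr (hc w hw) hb

theorem Context.right {v u u' t : V} {a c : EReal} (hr : Γ.Rule v u u') (ha : Γ.Der u a)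
    (hc : Γ.Context u' t c) : Γ.Context v t (a + c) := fun w hw => by
  rw [add_left_comm]
  exact .rule hr ha (hc w hw)

theorem Context.iterate {v : V} {c w : EReal} (hc : Γ.Context v v c) (hw : Γ.Der v w) (m : ℕ) :
    Γ.Der v (w + m • c) := by
  induction m with
  | zero => simpa using hw
  | succ m ih => rw [succ_nsmul, ← add_assoc]; exact hc _ ih

/-- If the derivable weights are bounded, then cutting out a context does not decrease the
weight. -/
theorem Context.add_le (hΓ : ∀ v, ∃ b : ℝ, ∀ w, Γ.Der v w → w ≤ b) {v : V} {c w : EReal}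
    (hc : Γ.Context v v c) (hw : Γ.Der v w) : w + c ≤ w := by
  obtain ⟨b, hb⟩ := hΓ v
  induction w with
  | bot => simp
  | top => exact absurd (hb _ hw) (not_le.2 (EReal.coe_lt_top b))
  | coe w =>
    induction c with
    | bot => simp
    | top =>
      have := hb _ (hc _ hw)
      rw [EReal.coe_add_top] at this
      exact absurd this (not_le.2 (EReal.coe_lt_top b))
    | coe c =>
      rw [← EReal.coe_add, EReal.coe_le_coe_iff]
      by_contra! hlt
      -- A positive context from `v` to itself could be pumped beyond the bound.
      have hpos : 0 < c := by linarith
      obtain ⟨m, hm⟩ := exists_nat_gt ((b - w) / c)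
      have := hb _ (hc.iterate hw m)
      rw [← EReal.coe_nsmul, ← EReal.coe_add, EReal.coe_le_coe_iff, nsmul_eq_mul] at this
      rw [div_lt_iff₀ hpos] at hm
      linarith

/-- Either the branches of a derivation can be made free of repetitions without decreasing the
weight, or one of them meets a label in `S`. -/
theorem DerSize.avoid_or_context [DecidableEq V] (hΓ : ∀ v, ∃ b : ℝ, ∀ w, Γ.Der v w → w ≤ b)
    (m : ℕ) : ∀ (S : Finset V) (v : V) (w : EReal), Γ.DerSize m v w →
      (∃ w', w ≤ w' ∧ Γ.DerAvoid S v w') ∨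
      ∃ u ∈ S, ∃ c w' m', m' ≤ m ∧ Γ.Context v u c ∧ Γ.DerSize m' u w' ∧ w ≤ w' + c := by
  induction m using Nat.strong_induction_on with
  | _ m ih =>
    intro S v w h
    by_cases hv : v ∈ S
    · exact Or.inr ⟨v, hv, 0, w, m, le_rfl, fun w hw => by simpa using hw, h, by simp⟩
    -- a branch that meets `v` again can be shortened
    have cut : ∀ t ∈ insert v S, ∀ c w' m', m' < m → Γ.Context v t c → Γ.DerSize m' t w' →
        w ≤ w' + c → (∃ w', w ≤ w' ∧ Γ.DerAvoid S v w') ∨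
        ∃ u ∈ S, ∃ c w' m', m' ≤ m ∧ Γ.Context v u c ∧ Γ.DerSize m' u w' ∧ w ≤ w' + c := by
      intro t ht c w' m' hm' hc ht' hle
      rcases Finset.mem_insert.1 ht with rfl | ht
      · have hle' := hle.trans (hc.add_le hΓ ht'.der)
        rcases ih m' hm' S t w' ht' with ⟨w'', h₁, h₂⟩ | ⟨u, hu, c, w'', k, hk, h₁, h₂, h₃⟩
        · exact Or.inl ⟨w'', hle'.trans h₁, h₂⟩
        · exact Or.inr ⟨u, hu, c, w'', k, hk.trans hm'.le, h₁, h₂, hle'.trans h₃⟩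
      · exact Or.inr ⟨t, ht, c, w', m', hm'.le, hc, ht', hle⟩
    cases h with
    | init h => exact Or.inl ⟨w, le_rfl, .init h⟩
    | @rule m₁ m₂ _ u u' a b hr ha hb =>
      rcases ih m₁ (by omega) (insert v S) u a ha with
        ⟨a', hle, ha'⟩ | ⟨t, ht, c, w', m', hm', hc, ht', hle⟩
      · rcases ih m₂ (by omega) (insert v S) u' b hb with
          ⟨b', hle', hb'⟩ | ⟨t, ht, c, w', m', hm', hc, ht', hle'⟩
        · exact Or.inl ⟨a' + b', add_le_add hle hle', .rule hv hr ha' hb'⟩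
        · refine cut t ht (a + c) w' m' (by omega) (.right hr ha.der hc) ht' ?_
          rw [add_left_comm]
          exact add_le_add le_rfl hle'
      · refine cut t ht (c + b) w' m' (by omega) (.left hr hc hb.der) ht' ?_
        rw [← add_assoc]
        exact add_le_add hle le_rfl

/-- With `S = ∅` a branch has no forbidden label to meet. -/
theorem Der.exists_avoid [DecidableEq V] (hΓ : ∀ v, ∃ b : ℝ, ∀ w, Γ.Der v w → w ≤ b)
    {v : V} {w : EReal} (h : Γ.Der v w) : ∃ w', w ≤ w' ∧ Γ.DerAvoid ∅ v w' := by
  obtain ⟨m, hm⟩ := h.exists_size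
  rcases hm.avoid_or_context hΓ m ∅ v w with h | ⟨u, hu, _⟩
  · exact h
  · simp at hu

/-! ### Domination of derivations of bounded depth -/

variable (Γ) in
/-- `P` dominates all derivations of depth at most `h`. -/
def Complete [Fintype V] [DecidableEq V] (h : ℕ) (P : V → EReal) : Prop :=
  ∀ S v w, (Finset.card Sᶜ) ≤ h → Γ.DerAvoid S v w → w ≤ P v

section Complete

variable [Fintype V] [DecidableEq V]

theorem complete_zero {P : V → EReal} (hP : ∀ v w, Γ.Init v w → w ≤ P v) : Γ.Complete 0 P := by
  intro S v w hS h
  cases h with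
  | init h => exact hP _ _ h
  | rule hv =>
    rw [Nat.le_zero, Finset.card_eq_zero, Finset.compl_eq_empty_iff] at hS
    exact absurd (hS ▸ Finset.mem_univ _) hv

theorem Complete.init_le {h : ℕ} {P : V → EReal} (hP : Γ.Complete h P) {v : V} {w : EReal}
    (hw : Γ.Init v w) : w ≤ P v :=
  hP Finset.univ v w (by simp) (.init hw)

/-- Expanding `v` moves it into the set of forbidden labels, so the number of labels still available
drops by one. That number bounds the remaining depth. -/
theorem Complete.succ {h : ℕ} {P P' : V → EReal} (hP : Γ.Complete h P) (hle : ∀ v, P v ≤ P' v)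
    (hr : ∀ v u u', Γ.Rule v u u' → P u + P u' ≤ P' v) : Γ.Complete (h + 1) P' := by
  intro S v w hS hd
  cases hd with
  | init hi => exact (hP.init_le hi).trans (hle v)
  | rule hv hr' ha hb =>
    have hS' : (insert v S)ᶜ.card ≤ h := by
      rw [Finset.compl_insert, Finset.card_erase_of_mem (Finset.mem_compl.2 hv)]
      omega
    exact (add_le_add (hP _ _ _ hS' ha) (hP _ _ _ hS' hb)).trans (hr _ _ _ hr')

/-- Depth `Fintype.card V` suffices. -/
theorem Complete.rule_le (hΓ : ∀ v, ∃ b : ℝ, ∀ w, Γ.Der v w → w ≤ b) {h : ℕ} {P : V → EReal}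
    (hP : Γ.Complete h P) (hcard : Fintype.card V ≤ h) (hsound : ∀ v, Γ.Der v (P v))
    {v u u' : V} (hr : Γ.Rule v u u') : P u + P u' ≤ P v := by
  -- The sum is itself derivable from `v`, hence dominated by a derivation without repetitions,
  -- whose depth `P` already covers.
  obtain ⟨w, hle, hw⟩ := (Der.rule hr (hsound u) (hsound u')).exists_avoid hΓ
  exact hle.trans (hP ∅ v w (by simpa using hcard) hw)

end Complete

end Grammar

/-! ## The grammar of the derived graphs -/

theorem botToEReal_le_coe {a : WithBot ℝ} {r : ℝ} :
    botToEReal a ≤ (r : EReal) ↔ a ≤ (r : WithBot ℝ) := by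
  induction a using WithBot.recBotCoe with
  | bot => simp [botToEReal]
  | coe a =>
    change (a : EReal) ≤ _ ↔ _
    rw [EReal.coe_le_coe_iff, WithBot.coe_le_coe]

theorem neg_topToEReal (b : WithTop ℝ) : -topToEReal b = botToEReal (negTop b) := by
  induction b using WithTop.recTopCoe with
  | top => rfl
  | coe b => exact (EReal.coe_neg b).symm

theorem ereal_add_coe_le_coe {a : EReal} {x y : ℝ} :
    a + (x : EReal) ≤ (y : EReal) ↔ a ≤ ((y - x : ℝ) : EReal) := by
  induction a with
  | bot => simp
  | top => rw [EReal.top_add_coe, top_le_iff, top_le_iff]; simp only [EReal.coe_ne_top]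
  | coe a => rw [← EReal.coe_add, EReal.coe_le_coe_iff, EReal.coe_le_coe_iff, le_sub_iff_add_le]

/-- The four kinds of matrices: `P` for paths that return to the level at which they start without
going below it, `T` for a step `R` followed by such a path, and `L`, `R`. -/
inductive Kind
  | P | R | L | T
  deriving DecidableEq

instance : Fintype Kind where
  elems := {.P, .R, .L, .T}
  complete a := by cases a <;> simp

namespace CharMatrices

variable {n : ℕ} (I : CharMatrices n)

/-- Initial weights of the grammar of paths. -/
inductive PathInit : Kind × Fin n × Fin n → EReal → Prop
  | lower (i j : Fin n) : PathInit (.P, i, j) (botToEReal (I.A 0 i j))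
  | upper (i j : Fin n) : PathInit (.P, i, j) (-topToEReal (I.B 0 j i))
  | refl (i : Fin n) : PathInit (.P, i, i) 0
  | up (i j : Fin n) : PathInit (.R, i, j) (botToEReal (I.A 1 i j))
  | wait (i : Fin n) : PathInit (.R, i, i) 0
  | down (i j : Fin n) : PathInit (.L, i, j) (-topToEReal (I.B 1 j i))
  | bot (i j : Fin n) : PathInit (.T, i, j) ⊥

/-- Rules for kinds of matrices. -/
inductive KindRule : Kind → Kind → Kind → Prop
  | trans : KindRule .P .P .P
  | up : KindRule .T .P .R
  | down : KindRule .P .L .T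

/-- The grammar of the paths in the derived graphs. -/
def pathGrammar : Grammar (Kind × Fin n × Fin n) where
  Init := I.PathInit
  Rule v u u' := KindRule v.1 u.1 u'.1 ∧ v.2.1 = u.2.1 ∧ u.2.2 = u'.2.1 ∧ v.2.2 = u'.2.2

/-- The matrix family `P` is closed under the rules. -/
def IsClosed (P : Kind → Fin n → Fin n → EReal) : Prop :=
  ∀ a b c, KindRule a b c → ∀ i j k, P b i k + P c k j ≤ P a i j

/-- The matrix family `P` dominates the initial weights. -/
def DominatesInit (P : Kind → Fin n → Fin n → EReal) : Prop :=
  ∀ v w, I.PathInit v w → w ≤ P v.1 v.2.1 v.2.2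

variable {I}

theorem PathInit.ne_top {v : Kind × Fin n × Fin n} {w : EReal} (h : I.PathInit v w) : w ≠ ⊤ := by
  have hb : ∀ a : WithBot ℝ, botToEReal a ≠ ⊤ := by
    intro a
    induction a using WithBot.recBotCoe with
    | bot => exact bot_ne_top
    | coe a => exact EReal.coe_ne_top a
  cases h <;> simp only [neg_topToEReal, ne_eq, hb, not_false_eq_true, EReal.zero_ne_top, bot_ne_top]

theorem der_ne_top {v : Kind × Fin n × Fin n} {w : EReal} (h : I.pathGrammar.Der v w) :
    w ≠ ⊤ := by
  induction h with
  | init h => exact h.ne_top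
  | rule _ _ _ ih ih' => exact EReal.add_ne_top ih ih'

/-- Weights derived in the grammar of paths bound the differences of the firing times. -/
theorem IsSolution.bound {k₀ : ℕ} (hk₀ : k₀ ≤ 1) {x : Fin n → ℕ → ℝ} (hx : I.IsSolution k₀ x)
    {v : Kind × Fin n × Fin n} {w : EReal} (h : I.pathGrammar.Der v w) :
    match v with
    | (.P, i, j) => ∀ k, 1 ≤ k → w + (x j k : EReal) ≤ (x i k : EReal)
    | (.R, i, j) => ∀ k, k₀ ≤ k → w + (x j k : EReal) ≤ (x i (k + 1) : EReal)
    | (.L, i, j) => ∀ k, k₀ ≤ k → w + (x j (k + 1) : EReal) ≤ (x i k : EReal)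
    | (.T, i, j) => ∀ k, k₀ ≤ k → w + (x j k : EReal) ≤ (x i (k + 1) : EReal) := by
  obtain ⟨hC, hR, hL⟩ := hx
  induction h with
  | init h =>
    cases h with
    | lower i j =>
      intro k hk
      rw [ereal_add_coe_le_coe, botToEReal_le_coe]
      exact (le_max_left _ _).trans (hC k hk i j)
    | upper i j =>
      intro k hk
      rw [neg_topToEReal, ereal_add_coe_le_coe, botToEReal_le_coe]
      exact (le_max_right _ _).trans (hC k hk i j)
    | refl i => intro k _; simp
    | up i j =>
      intro k hk
      rw [ereal_add_coe_le_coe, botToEReal_le_coe]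
      exact (I.R_le_iff.1 (hR k hk)).1 i j
    | wait i =>
      intro k hk
      rw [zero_add, EReal.coe_le_coe_iff]
      exact (I.R_le_iff.1 (hR k hk)).2 i
    | down i j =>
      intro k hk
      rw [neg_topToEReal, ereal_add_coe_le_coe, botToEReal_le_coe]
      exact hL k hk i j
    | bot i j => intro k _; simp
  | @rule v u u' a b hr _ _ ih ih' =>
    obtain ⟨α, i, j⟩ := v
    obtain ⟨β, i', l⟩ := u
    obtain ⟨γ, l', j'⟩ := u'
    obtain ⟨hk, h₁, h₂, h₃⟩ := hr
    simp only at hk h₁ h₂ h₃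
    subst h₁ h₂ h₃
    cases hk with
    | trans =>
      intro k hk
      rw [add_assoc]
      exact (add_le_add le_rfl (ih' k hk)).trans (ih k hk)
    | up =>
      intro k hk
      rw [add_assoc]
      -- The excursion after the step up runs at level `k + 1`, which is admissible even for `k =
      -- 0`.
      exact (add_le_add le_rfl (ih' k hk)).trans (ih (k + 1) k.succ_pos)
    | down =>
      intro k hk
      rw [add_assoc]
      exact (add_le_add le_rfl (ih' k (hk₀.trans hk))).trans (ih k (hk₀.trans hk))

theorem IsSolution.exists_bound {k₀ : ℕ} (hk₀ : k₀ ≤ 1) {x : Fin n → ℕ → ℝ}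
    (hx : I.IsSolution k₀ x) (v : Kind × Fin n × Fin n) :
    ∃ b : ℝ, ∀ w, I.pathGrammar.Der v w → w ≤ b := by
  obtain ⟨α, i, j⟩ := v
  cases α with
  | P => exact ⟨_, fun w hw => ereal_add_coe_le_coe.1 (hx.bound hk₀ hw 1 le_rfl)⟩
  | R => exact ⟨_, fun w hw => ereal_add_coe_le_coe.1 (hx.bound hk₀ hw 1 hk₀)⟩
  | L => exact ⟨_, fun w hw => ereal_add_coe_le_coe.1 (hx.bound hk₀ hw 1 hk₀)⟩
  | T => exact ⟨_, fun w hw => ereal_add_coe_le_coe.1 (hx.bound hk₀ hw 1 hk₀)⟩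

/-! ### Firing times from a closed family of matrices -/

/-- Max-plus multiplication of a real vector by a matrix with nonnegative diagonal. -/
theorem exists_maxPlus_mulVec (M : Fin n → Fin n → EReal) (htop : ∀ i j, M i j ≠ ⊤)
    (hdiag : ∀ i, 0 ≤ M i i) (x : Fin n → ℝ) :
    ∃ y : Fin n → ℝ, (∀ i j, M i j + (x j : EReal) ≤ (y i : EReal)) ∧
      ∀ i, ∃ j, (y i : EReal) = M i j + (x j : EReal) := by
  have h : ∀ i, ∃ y : ℝ, (∀ j, M i j + (x j : EReal) ≤ (y : EReal)) ∧
      ∃ j, (y : EReal) = M i j + (x j : EReal) := by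
    intro i
    have : Nonempty (Fin n) := ⟨i⟩
    -- The maximum is attained. It is real, because the diagonal term keeps it above `-∞` and no
    -- entry is `+∞`.
    obtain ⟨j, hj⟩ := Finite.exists_max fun j => M i j + (x j : EReal)
    have hbot : M i j + (x j : EReal) ≠ ⊥ := by
      have := (add_le_add (hdiag i) (le_refl (x i : EReal))).trans (hj i)
      rw [zero_add] at this
      exact ne_bot_of_le_ne_bot (EReal.coe_ne_bot _) this
    have hy := EReal.coe_toReal (EReal.add_ne_top (htop i j) (EReal.coe_ne_top (x j))) hbot
    exact ⟨_, fun l => by rw [hy]; exact hj l, j, hy⟩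
  choose y h₁ h₂ using h
  exact ⟨y, h₁, h₂⟩

/-- A closed family of matrices yields firing times, with any constant initial vector. -/
theorem exists_isSolution {P : Kind → Fin n → Fin n → EReal} (hP : IsClosed P)
    (hinit : I.DominatesInit P) (htop : ∀ a i j, P a i j ≠ ⊤) (t₀ : ℝ) :
    ∃ x : Fin n → ℕ → ℝ, (∀ i, x i 0 = t₀) ∧ I.IsSolution 1 x ∧
      ((∀ i j k, P .L i k + P .T k j ≤ 0) → I.IsSolution 0 x) := by
  have hP0 : ∀ i, 0 ≤ P .P i i := fun i => hinit _ _ (.refl i)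
  have hR0 : ∀ i, 0 ≤ P .R i i := fun i => hinit _ _ (.wait i)
  choose f hf hf' using exists_maxPlus_mulVec (P .P) (htop _) hP0
  choose g hg hg' using exists_maxPlus_mulVec (P .R) (htop _) hR0
  -- Each level is the image of the previous one under `R` and then `P`. Closedness of `P` under
  -- concatenation gives the inequalities within a level.
  obtain ⟨X, hX0, hX⟩ : ∃ X : ℕ → Fin n → ℝ, (∀ i, X 0 i = t₀) ∧ ∀ k, X (k + 1) = f (g (X k)) :=
    ⟨fun k => Nat.rec (fun _ => t₀) (fun _ x => f (g x)) k, fun _ => rfl, fun _ => rfl⟩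
  have hXP : ∀ k, 1 ≤ k → ∀ i j, P .P i j + (X k j : EReal) ≤ (X k i : EReal) := by
    intro k hk i j
    obtain ⟨k, rfl⟩ := Nat.exists_eq_add_of_le' hk
    rw [hX]
    obtain ⟨l, hl⟩ := hf' (g (X k)) j
    rw [hl, ← add_assoc]
    exact (add_le_add (hP _ _ _ .trans i l j) le_rfl).trans (hf _ i l)
  have hXR : ∀ k i j, P .R i j + (X k j : EReal) ≤ (X (k + 1) i : EReal) := by
    intro k i j
    rw [hX]
    have h₁ := (add_le_add (hP0 i) le_rfl).trans (hf (g (X k)) i i)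
    rw [zero_add] at h₁
    exact (hg _ i j).trans h₁
  -- Tracing the attained maxima back to level `k` shows that a step down from level `k + 1` costs
  -- at most a product of `L` and `T` applied to `X k`.
  have hXL : ∀ k i j, ∃ m, P .L i j + (X (k + 1) j : EReal) ≤
      P .L i j + P .T j m + (X k m : EReal) := by
    intro k i j
    obtain ⟨l, hl⟩ := hf' (g (X k)) j
    obtain ⟨m, hm⟩ := hg' (X k) l
    refine ⟨m, ?_⟩
    rw [hX, hl, hm, add_assoc]
    refine add_le_add le_rfl ?_
    rw [← add_assoc]
    exact add_le_add (hP _ _ _ .up j m l) le_rfl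
  have hC : ∀ k, 1 ≤ k → ∀ i j, I.C i j ≤ ((X k i - X k j : ℝ) : WithBot ℝ) := by
    intro k hk i j
    have := ereal_add_coe_le_coe.1 (hXP k hk i j)
    refine max_le ?_ ?_
    · exact botToEReal_le_coe.1 ((hinit _ _ (.lower i j)).trans this)
    · rw [← botToEReal_le_coe, ← neg_topToEReal]
      exact (hinit _ _ (.upper i j)).trans this
  have hR : ∀ k i j, I.R i j ≤ ((X (k + 1) i - X k j : ℝ) : WithBot ℝ) := by
    intro k
    refine I.R_le_iff.2 ⟨fun i j => ?_, fun i => ?_⟩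
    · exact botToEReal_le_coe.1
        ((hinit _ _ (.up i j)).trans (ereal_add_coe_le_coe.1 (hXR k i j)))
    · have := (add_le_add (hR0 i) le_rfl).trans (hXR k i i)
      rwa [zero_add, EReal.coe_le_coe_iff] at this
  have hL : ∀ k, (∀ i j m, P .L i j + P .T j m + (X k m : EReal) ≤ (X k i : EReal)) →
      ∀ i j, I.L i j ≤ ((X k i - X (k + 1) j : ℝ) : WithBot ℝ) := by
    intro k hk i j
    obtain ⟨m, hm⟩ := hXL k i j
    have := ereal_add_coe_le_coe.1 (hm.trans (hk i j m))
    unfold L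
    rw [← botToEReal_le_coe, ← neg_topToEReal]
    exact (hinit _ _ (.down i j)).trans this
  -- From level `1` on, `X k` respects `P`, which dominates the products of `L` and `T`. The
  -- constant vector `X 0` need not respect `P`, so level `0` requires these products to be
  -- nonpositive.
  have hL1 : ∀ k, 1 ≤ k → ∀ i j, I.L i j ≤ ((X k i - X (k + 1) j : ℝ) : WithBot ℝ) :=
    fun k hk => hL k fun i j m =>
      (add_le_add (hP _ _ _ .down i m j) le_rfl).trans (hXP k hk i m)
  refine ⟨fun i k => X k i, hX0, ⟨hC, fun k _ => hR k, hL1⟩,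
    fun h0 => ⟨hC, fun k _ => hR k, fun k _ => ?_⟩⟩
  rcases k.eq_zero_or_pos with rfl | hk
  · refine hL 0 fun i j m => ?_
    have := add_le_add (h0 i m j) (le_refl (t₀ : EReal))
    rw [hX0, hX0]
    rwa [zero_add] at this
  · exact hL1 k hk

/-! ### Criteria in terms of the computed matrices -/

/-- The loose consistency criterion. -/
theorem consistentLoose_iff_isClosed {P : Kind → Fin n → Fin n → EReal} {h : ℕ}
    (hsound : ∀ v : Kind × Fin n × Fin n, I.pathGrammar.Der v (P v.1 v.2.1 v.2.2))
    (hcompl : I.pathGrammar.Complete h fun v => P v.1 v.2.1 v.2.2)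
    (hh : Fintype.card (Kind × Fin n × Fin n) ≤ h) :
    I.ConsistentLoose ↔ IsClosed P := by
  rw [consistentLoose_iff]
  constructor
  · rintro ⟨x, hx⟩ a b c hr i j k
    exact hcompl.rule_le (hx.exists_bound le_rfl) hh hsound
      (v := (a, i, j)) (u := (b, i, k)) (u' := (c, k, j)) ⟨hr, rfl, rfl, rfl⟩
  · intro hP
    obtain ⟨x, _, hx, _⟩ := exists_isSolution hP (fun v w hw => hcompl.init_le hw)
      (fun a i j => der_ne_top (hsound (a, i, j))) 0
    exact ⟨x, hx⟩

/-- The strict consistency criterion. -/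
theorem consistentStrict_iff_isClosed {P : Kind → Fin n → Fin n → EReal} {h : ℕ}
    (hsound : ∀ v : Kind × Fin n × Fin n, I.pathGrammar.Der v (P v.1 v.2.1 v.2.2))
    (hcompl : I.pathGrammar.Complete h fun v => P v.1 v.2.1 v.2.2)
    (hh : Fintype.card (Kind × Fin n × Fin n) ≤ h) (t₀ : ℝ) :
    I.ConsistentStrict t₀ ↔ IsClosed P ∧ ∀ i j k, P .L i k + P .T k j ≤ 0 := by
  rw [consistentStrict_iff]
  constructor
  · rintro ⟨x, hx, h0⟩
    refine ⟨fun a b c hr i j k => ?_, fun i j k => ?_⟩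
    · exact hcompl.rule_le (hx.exists_bound zero_le_one) hh hsound
        (v := (a, i, j)) (u := (b, i, k)) (u' := (c, k, j)) ⟨hr, rfl, rfl, rfl⟩
    -- Going up from level `0` and back down compares two firing times that both equal `t₀`.
    · have hT := hx.bound zero_le_one (hsound (.T, k, j)) 0 le_rfl
      have hL := hx.bound zero_le_one (hsound (.L, i, k)) 0 le_rfl
      have := (add_le_add (le_refl (P .L i k)) hT).trans hL
      rw [← add_assoc, h0, h0, ereal_add_coe_le_coe, sub_self] at this
      exact this
  · rintro ⟨hP, h0⟩
    obtain ⟨x, hx0, _, hx⟩ := exists_isSolution hP (fun v w hw => hcompl.init_le hw)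
      (fun a i j => der_ne_top (hsound (a, i, j))) t₀
    exact ⟨x, hx h0, hx0⟩

end CharMatrices

namespace Machine

/-! ## Bounded loops -/

/-- From `s`, the program `p` halts in `s'` after at most `T` steps. -/
def Runs (p : Prog) (T : ℕ) (s s' : State) : Prop :=
  ∃ t, Exec p s t s' ∧ t ≤ T

theorem Runs.instr (c : Instr) (s : State) : Runs (.instr c) 1 s (c.run s) :=
  ⟨1, .instr c s, le_rfl⟩

theorem Runs.seq {p q : Prog} {T T' : ℕ} {s s' s'' : State} (h : Runs p T s s')
    (h' : Runs q T' s' s'') : Runs (.seq p q) (T + T') s s'' := by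
  obtain ⟨t, he, ht⟩ := h
  obtain ⟨t', he', ht'⟩ := h'
  exact ⟨_, .seq he he', add_le_add ht ht'⟩

theorem Runs.mono {p : Prog} {T T' : ℕ} {s s' : State} (h : Runs p T s s') (hT : T ≤ T') :
    Runs p T' s s' := by
  obtain ⟨t, he, ht⟩ := h
  exact ⟨t, he, ht.trans hT⟩

/-- Arrays and the answer register `6`. -/
structure Data where
  num : ℕ → ℕ → ℕ → EReal
  flag : ℕ

def State.data (s : State) : Data := ⟨s.num, s.idx 6⟩

theorem State.data_setIdx {s : State} {r v : ℕ} (hr : r < 6) : (s.setIdx r v).data = s.data := by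
  simp [State.data, State.setIdx, hr.ne']

/-- Execute `p` with the values `0, …, n - 1` of the register `r`, where `n` is the value of the
register `0`. -/
def forLoop (r : ℕ) (p : Prog) : Prog :=
  .seq (.instr (.idxZero r)) (.while (.idxLt r 0) (.seq p (.instr (.idxSucc r))))

/-- The body may overwrite registers above `r`, which allows nesting with increasing loop registers.
A round costs `T + 2`, counting test and increment; the initial reset and the failing last test are
absorbed by the extra round in the bound. -/
theorem forLoop_rule {r : ℕ} (hr : 0 < r) (hr' : r < 6) {base : ℕ → ℕ} {p : Prog} {T : ℕ}
    {J : ℕ → Data → Prop}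
    (hp : ∀ s : State, (∀ q < r, s.idx q = base q) → s.idx r < base 0 → J (s.idx r) s.data →
      ∃ s', Runs p T s s' ∧ (∀ q < r + 1, s'.idx q = s.idx q) ∧ J (s.idx r + 1) s'.data)
    {s : State} (hs : ∀ q < r, s.idx q = base q) (h0 : J 0 s.data) :
    ∃ s', Runs (forLoop r p) ((T + 2) * (base 0 + 1)) s s' ∧ (∀ q < r, s'.idx q = s.idx q) ∧
      J (base 0) s'.data := by
  have hwhile : ∀ (d : ℕ) (s : State), s.idx r + d = base 0 → (∀ q < r, s.idx q = base q) →
      J (s.idx r) s.data →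
      ∃ s', Runs (.while (.idxLt r 0) (.seq p (.instr (.idxSucc r)))) (d * (T + 2) + 1) s s' ∧
        (∀ q < r, s'.idx q = base q) ∧ J (base 0) s'.data := by
    intro d
    induction d with
    | zero =>
      intro s hd hs hJ
      have hb : ¬ (Test.idxLt r 0).Holds s := by
        change ¬ s.idx r < s.idx 0
        rw [hs 0 hr]
        omega
      exact ⟨s, ⟨1, .while_false hb, by omega⟩, hs, by rwa [← hd]⟩
    | succ d ih =>
      intro s hd hs hJ
      have hb : (Test.idxLt r 0).Holds s := by
        change s.idx r < s.idx 0
        rw [hs 0 hr]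
        omega
      obtain ⟨s₁, ⟨t₁, he₁, ht₁⟩, hs₁, hJ₁⟩ := hp s hs (by omega) hJ
      have hidx : (s₁.setIdx r (s₁.idx r + 1)).idx r = s.idx r + 1 := by
        simp [State.setIdx, hs₁ r (Nat.lt_succ_self r)]
      obtain ⟨s₂, ⟨t₂, he₂, ht₂⟩, hs₂, hJ₂⟩ := ih (s₁.setIdx r (s₁.idx r + 1))
        (by rw [hidx]; omega)
        (fun q hq => by
          rw [← hs q hq, ← hs₁ q (by omega)]
          simp [State.setIdx, hq.ne])
        (by rwa [State.data_setIdx hr', hidx])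
      refine ⟨s₂, ⟨_, .while_true hb (.seq he₁ (.instr _ _)) he₂, ?_⟩, hs₂, hJ₂⟩
      rw [Nat.succ_mul]
      omega
  have hidx : (s.setIdx r 0).idx r = 0 := by simp [State.setIdx]
  obtain ⟨s', ⟨t, he, ht⟩, hs', hJ⟩ := hwhile (base 0) (s.setIdx r 0) (by omega)
    (fun q hq => by rw [← hs q hq]; simp [State.setIdx, hq.ne])
    (by rwa [State.data_setIdx hr', hidx])
  refine ⟨s', ⟨_, .seq (.instr _ _) he, ?_⟩, fun q hq => by rw [hs' q hq, hs q hq], hJ⟩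
  rw [Nat.mul_succ, mul_comm (T + 2)]
  omega

/-- Execute `p` with all triples of values below `n` of the registers `3`, `4`, `5`. -/
def forTriples (p : Prog) : Prog :=
  forLoop 3 (forLoop 4 (forLoop 5 p))

/-- A goal `G i j k` reached at its own triple is never destroyed later, so all goals hold at the
end. The inner invariants record preservation of every goal, to protect those of earlier outer
rounds. -/
theorem forTriples_rule {n : ℕ} {p : Prog} {T : ℕ} {Inv : Data → Prop}
    {G : ℕ → ℕ → ℕ → Data → Prop}
    (hp : ∀ s : State, s.idx 3 < n → s.idx 4 < n → s.idx 5 < n → Inv s.data →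
      ∃ s', Runs p T s s' ∧ (∀ q < 6, s'.idx q = s.idx q) ∧ Inv s'.data ∧
        G (s.idx 3) (s.idx 4) (s.idx 5) s'.data ∧ ∀ i j k, G i j k s.data → G i j k s'.data)
    {s : State} (hn : s.idx 0 = n) (hs : Inv s.data) :
    ∃ s', Runs (forTriples p) ((T + 6) * (n + 1) ^ 3) s s' ∧ (∀ q < 3, s'.idx q = s.idx q) ∧
      Inv s'.data ∧ ∀ i < n, ∀ j < n, ∀ k < n, G i j k s'.data := by
  obtain ⟨s', hrun, hidx, hJ⟩ := forLoop_rule (r := 3) (by omega) (by omega) (base := s.idx)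
    (p := forLoop 4 (forLoop 5 p)) (T := ((T + 2) * (n + 1) + 2) * (n + 1))
    (J := fun i d => Inv d ∧ ∀ i' < i, ∀ j < n, ∀ k < n, G i' j k d)
    (fun s₁ hs₁ hlt₁ hJ₁ => by
      have hn₁ : s₁.idx 0 = n := (hs₁ 0 (by omega)).trans hn
      obtain ⟨s', hrun, hidx, hJ⟩ := forLoop_rule (r := 4) (by omega) (by omega) (base := s₁.idx)
        (p := forLoop 5 p) (T := (T + 2) * (n + 1))
        (J := fun j d => Inv d ∧ (∀ i j k, G i j k s₁.data → G i j k d) ∧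
          ∀ j' < j, ∀ k < n, G (s₁.idx 3) j' k d)
        (fun s₂ hs₂ hlt₂ hJ₂ => by
          have hn₂ : s₂.idx 0 = n := (hs₂ 0 (by omega)).trans hn₁
          obtain ⟨s', hrun, hidx, hJ⟩ := forLoop_rule (r := 5) (by omega) (by omega)
            (base := s₂.idx) (p := p) (T := T)
            (J := fun k d => Inv d ∧ (∀ i j k, G i j k s₂.data → G i j k d) ∧
              ∀ k' < k, G (s₂.idx 3) (s₂.idx 4) k' d)
            (fun s₃ hs₃ hlt₃ hJ₃ => by
              have h₃ := hs₃ 3 (by omega)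
              have h₃' := hs₂ 3 (by omega)
              have h₄ := hs₃ 4 (by omega)
              obtain ⟨s', hrun, hidx, hI, hG, hmono⟩ :=
                hp s₃ (by omega) (by omega) (by omega) hJ₃.1
              refine ⟨s', hrun, hidx, hI, fun i j k h => hmono _ _ _ (hJ₃.2.1 i j k h),
                fun k hk => ?_⟩
              rcases Nat.lt_succ_iff_lt_or_eq.1 hk with hk | rfl
              · exact hmono _ _ _ (hJ₃.2.2 k hk)
              · rwa [← h₃, ← h₄])
            (s := s₂) (fun _ _ => rfl)
            ⟨hJ₂.1, fun _ _ _ h => h, fun k hk => absurd hk k.not_lt_zero⟩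
          rw [hn₂] at hrun hJ
          refine ⟨s', hrun, hidx, hJ.1, fun i j k h => hJ.2.1 _ _ _ (hJ₂.2.1 i j k h),
            fun j hj k hk => ?_⟩
          rw [← hs₂ 3 (by omega)]
          rcases Nat.lt_succ_iff_lt_or_eq.1 hj with hj | rfl
          · refine hJ.2.1 _ _ _ ?_
            rw [hs₂ 3 (by omega)]
            exact hJ₂.2.2 j hj k hk
          · exact hJ.2.2 k hk)
        (s := s₁) (fun _ _ => rfl)
        ⟨hJ₁.1, fun _ _ _ h => h, fun j hj => absurd hj j.not_lt_zero⟩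
      rw [hn₁] at hrun hJ
      refine ⟨s', hrun, hidx, hJ.1, fun i hi j hj k hk => ?_⟩
      rcases Nat.lt_succ_iff_lt_or_eq.1 hi with hi | rfl
      · exact hJ.2.1 _ _ _ (hJ₁.2 i hi j hj k hk)
      · exact hJ.2.2 j hj k hk)
    (s := s) (fun _ _ => rfl) ⟨hs, fun i hi => absurd hi i.not_lt_zero⟩
  rw [hn] at hrun hJ
  refine ⟨s', hrun.mono ?_, hidx, hJ.1, hJ.2⟩
  have h : 1 ≤ n + 1 := by omega
  generalize n + 1 = m at h
  have h₂ : m ≤ m ^ 2 := Nat.le_self_pow (by norm_num) m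
  have h₃ : m ^ 2 ≤ m ^ 3 := Nat.pow_le_pow_right h (by norm_num)
  calc (((T + 2) * m + 2) * m + 2) * m = (T + 2) * m ^ 3 + 2 * m ^ 2 + 2 * m := by ring
    _ ≤ (T + 2) * m ^ 3 + 2 * m ^ 3 + 2 * m ^ 3 := by omega
    _ = (T + 6) * m ^ 3 := by ring

/-! ## The parts of the program

The arrays `4`, …, `7` hold the matrices `P`, `R`, `L`, `T`; the array `8` is used for intermediate
results, and the array `9` remains zero. -/

/-- The array that holds a matrix. -/
def code : Kind → ℕ
  | .P => 4
  | .R => 5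
  | .L => 6
  | .T => 7

theorem code_lt (a : Kind) : code a < 8 := by cases a <;> decide

theorem code_injective : Function.Injective code := by
  intro a b h
  cases a <;> cases b <;> first | rfl | exact absurd h (by decide)

/-- The family of matrices in the memory. -/
def Data.mat (d : Data) (n : ℕ) (a : Kind) (i j : Fin n) : EReal := d.num (code a) i j

/-- `aᵢⱼ := max aᵢⱼ (bᵢₖ + cₖⱼ)` -/
def relax (a b c : Kind) : Prog :=
  .seq (.instr (.numAdd ⟨8, 3, 4⟩ ⟨code b, 3, 5⟩ ⟨code c, 5, 4⟩))
    (.instr (.numMax ⟨code a, 3, 4⟩ ⟨code a, 3, 4⟩ ⟨8, 3, 4⟩))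

theorem relax_runs (a b c : Kind) (s : State) :
    ∃ s', Runs (relax a b c) 2 s s' ∧ s'.idx = s.idx ∧
      ∀ q i j, q ≠ 8 → s'.num q i j =
        if q = code a ∧ i = s.idx 3 ∧ j = s.idx 4 then
          max (s.num (code a) (s.idx 3) (s.idx 4))
            (s.num (code b) (s.idx 3) (s.idx 5) + s.num (code c) (s.idx 5) (s.idx 4))
        else s.num q i j := by
  refine ⟨_, (Runs.instr _ _).seq (Runs.instr _ _), rfl, fun q i j hq => ?_⟩
  have h := (code_lt a).ne
  simp [Instr.run, State.setNum, State.get, hq, h]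

/-- Clear the register `6` unless `bᵢₖ + cₖⱼ` is at most the entry `i`, `j` of the array `q`. -/
def check (q : ℕ) (b c : Kind) : Prog :=
  .seq (.instr (.numAdd ⟨8, 3, 4⟩ ⟨code b, 3, 5⟩ ⟨code c, 5, 4⟩))
    -- Copying the register `0` to itself is a no-op.
    (.ite (.numLe ⟨8, 3, 4⟩ ⟨q, 3, 4⟩) (.instr (.idxCopy 0 0)) (.instr (.idxZero 6)))

theorem check_runs {q : ℕ} (hq : q ≠ 8) (b c : Kind) (s : State) :
    ∃ s', Runs (check q b c) 3 s s' ∧ (∀ r < 6, s'.idx r = s.idx r) ∧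
      (∀ q' ≠ 8, s'.num q' = s.num q') ∧
      ((s.num (code b) (s.idx 3) (s.idx 5) + s.num (code c) (s.idx 5) (s.idx 4) ≤
          s.num q (s.idx 3) (s.idx 4) ∧ s'.idx 6 = s.idx 6) ∨
        ¬ (s.num (code b) (s.idx 3) (s.idx 5) + s.num (code c) (s.idx 5) (s.idx 4) ≤
          s.num q (s.idx 3) (s.idx 4)) ∧ s'.idx 6 = 0) := by
  set s₁ := (Instr.numAdd ⟨8, 3, 4⟩ ⟨code b, 3, 5⟩ ⟨code c, 5, 4⟩).run s with hs₁
  have hnum : ∀ q' ≠ 8, s₁.num q' = s.num q' := by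
    intro q' hq'
    funext i j
    simp [hs₁, Instr.run, State.setNum, hq']
  have htest : (Test.numLe ⟨8, 3, 4⟩ ⟨q, 3, 4⟩).Holds s₁ ↔
      s.num (code b) (s.idx 3) (s.idx 5) + s.num (code c) (s.idx 5) (s.idx 4) ≤
        s.num q (s.idx 3) (s.idx 4) := by
    simp [Test.Holds, hs₁, Instr.run, State.setNum, State.get, hq]
  by_cases h : (Test.numLe ⟨8, 3, 4⟩ ⟨q, 3, 4⟩).Holds s₁
  · refine ⟨_, ⟨_, .seq (.instr _ _) (.ite_true h (.instr _ _)), le_rfl⟩, fun r _ => ?_, hnum,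
      Or.inl ⟨htest.1 h, ?_⟩⟩
    · simp only [Instr.run, State.setIdx]
      split_ifs with h0
      · rw [h0]; rfl
      · rfl
    · simp [Instr.run, State.setIdx, State.setNum]
  · refine ⟨_, ⟨_, .seq (.instr _ _) (.ite_false h (.instr _ _)), le_rfl⟩, fun r hr => ?_, hnum,
      Or.inr ⟨fun h' => h (htest.2 h'), ?_⟩⟩
    · simp [Instr.run, State.setIdx, State.setNum, hr.ne]
    · simp [Instr.run, State.setIdx]

/-- Only the scratch array `8` changes, so all tests refer to the original matrices. The flag is
never raised again, so successive checks form a conjunction. -/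
theorem checkAll_runs {n q : ℕ} (hq : q ≠ 8) (b c : Kind) {s : State} (hn : s.idx 0 = n)
    (hflag : s.idx 6 ≤ 1) :
    ∃ s', Runs (forTriples (check q b c)) (9 * (n + 1) ^ 3) s s' ∧ s'.idx 0 = n ∧
      s'.idx 6 ≤ 1 ∧ (∀ q' ≠ 8, s'.num q' = s.num q') ∧
      (s'.idx 6 = 1 ↔ s.idx 6 = 1 ∧ ∀ i j k : Fin n,
        s.num (code b) i k + s.num (code c) k j ≤ s.num q i j) := by
  obtain ⟨s', hrun, hidx, ⟨hnum, hle, h₁, h₂⟩, hG⟩ := forTriples_rule (n := n) (p := check q b c)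
    (T := 3)
    (Inv := fun d => (∀ q' ≠ 8, d.num q' = s.num q') ∧ d.flag ≤ 1 ∧ (d.flag = 1 → s.idx 6 = 1) ∧
      ((s.idx 6 = 1 ∧ ∀ i j k : Fin n,
        s.num (code b) i k + s.num (code c) k j ≤ s.num q i j) → d.flag = 1))
    (G := fun i j k d => d.flag = 1 →
      s.num (code b) i k + s.num (code c) k j ≤ s.num q i j)
    (fun s₁ h3 h4 h5 hI => by
      obtain ⟨hnum, hle, h₁, h₂⟩ := hI
      obtain ⟨s', hrun, hidx, hnum', h⟩ := check_runs hq b c s₁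
      have hb : s₁.num (code b) = s.num (code b) := hnum _ (code_lt b).ne
      have hc : s₁.num (code c) = s.num (code c) := hnum _ (code_lt c).ne
      have hq' : s₁.num q = s.num q := hnum _ hq
      rw [hb, hc, hq'] at h
      simp only [State.data] at hnum hle h₁ h₂ ⊢
      refine ⟨s', hrun, hidx, ⟨fun q' hq' => (hnum' q' hq').trans (hnum q' hq'), ?_⟩, ?_⟩
      · rcases h with ⟨_, h⟩ | ⟨hnot, h⟩
        · rw [h]; exact ⟨hle, h₁, h₂⟩
        · rw [h]
          exact ⟨zero_le_one, fun h => absurd h zero_ne_one,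
            fun h => absurd (h.2 ⟨_, h3⟩ ⟨_, h4⟩ ⟨_, h5⟩) hnot⟩
      · rcases h with ⟨hok, h⟩ | ⟨_, h⟩
        · rw [h]; exact ⟨fun _ => hok, fun _ _ _ h => h⟩
        · rw [h]; exact ⟨fun h => absurd h zero_ne_one, fun _ _ _ _ h => absurd h zero_ne_one⟩)
    hn ⟨fun _ _ => rfl, hflag, fun h => h, fun h => h.1⟩
  exact ⟨s', hrun, (hidx 0 (by omega)).trans hn, hle, hnum,
    fun h => ⟨h₁ h, fun i j k => hG i i.2 j j.2 k k.2 h⟩, h₂⟩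

variable {n : ℕ} (I : CharMatrices n)

/-- All matrix entries are derivable weights, and the array `9` is zero. -/
def Sound (d : Data) : Prop :=
  (∀ i j, d.num 9 i j = 0) ∧
    ∀ v : Kind × Fin n × Fin n, I.pathGrammar.Der v (d.mat n v.1 v.2.1 v.2.2)

/-- Updating in place is harmless: entries only grow, so each rule instance is satisfied at least
with the old right-hand sides, and every new entry is still derivable. -/
theorem relaxAll_runs {a b c : Kind} (hr : CharMatrices.KindRule a b c) {s : State}
    (hn : s.idx 0 = n) (hs : Sound I s.data) :
    ∃ s', Runs (forTriples (relax a b c)) (8 * (n + 1) ^ 3) s s' ∧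
      (∀ q < 3, s'.idx q = s.idx q) ∧ Sound I s'.data ∧ s'.idx 6 = s.idx 6 ∧
      (∀ a i j, s.data.mat n a i j ≤ s'.data.mat n a i j) ∧
      ∀ i j k, s.data.mat n b i k + s.data.mat n c k j ≤ s'.data.mat n a i j := by
  obtain ⟨s', hrun, hidx, ⟨hS, hf, hmono⟩, hG⟩ := forTriples_rule (n := n) (p := relax a b c)
    (T := 2)
    (Inv := fun d => Sound I d ∧ d.flag = s.idx 6 ∧
      ∀ a i j, s.data.mat n a i j ≤ d.mat n a i j)
    (G := fun i j k d => s.num (code b) i k + s.num (code c) k j ≤ d.num (code a) i j)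
    (fun s₁ h3 h4 h5 hI => by
      obtain ⟨⟨hz, hS⟩, hf, hmono⟩ := hI
      obtain ⟨s', hrun, hidx, hnum⟩ := relax_runs a b c s₁
      have hle : ∀ q i j, q ≠ 8 → s₁.num q i j ≤ s'.num q i j := by
        intro q i j hq
        rw [hnum q i j hq]
        split_ifs with h
        · obtain ⟨rfl, rfl, rfl⟩ := h
          exact le_max_left _ _
        · exact le_rfl
      refine ⟨s', hrun, fun q _ => by rw [hidx], ⟨⟨fun i j => ?_, ?_⟩, ?_, fun a i j => ?_⟩, ?_,
        fun i j k h => h.trans (hle _ _ _ (code_lt a).ne)⟩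
      · have h9 : 9 ≠ code a := ((code_lt a).trans (by norm_num)).ne'
        change s'.num 9 i j = 0
        rw [hnum 9 i j (by norm_num), if_neg fun h => h9 h.1]
        exact hz i j
      · rintro ⟨a', i, j⟩
        change I.pathGrammar.Der _ (s'.num (code a') i j)
        rw [hnum _ _ _ (code_lt a').ne]
        split_ifs with h
        · obtain ⟨ha, hi, hj⟩ := h
          obtain rfl := code_injective ha
          have hd := hS (a', i, j)
          have hd' := Grammar.Der.rule (Γ := I.pathGrammar) (v := (a', i, j))
            (u := (b, i, ⟨_, h5⟩)) (u' := (c, ⟨_, h5⟩, j)) ⟨hr, rfl, rfl, rfl⟩ (hS _) (hS _)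
          simp only [Data.mat, State.data] at hd hd'
          rw [hi, hj] at hd hd'
          rcases max_choice (s₁.num (code a') (s₁.idx 3) (s₁.idx 4))
            (s₁.num (code b) (s₁.idx 3) (s₁.idx 5) + s₁.num (code c) (s₁.idx 5) (s₁.idx 4)) with
            h | h <;> rw [h]
          · exact hd
          · exact hd'
        · exact hS (a', i, j)
      · change s'.idx 6 = _
        rw [hidx]
        exact hf
      · exact (hmono a i j).trans (hle _ _ _ (code_lt a).ne)
      · change _ ≤ s'.num (code a) _ _
        rw [hnum _ _ _ (code_lt a).ne, if_pos ⟨rfl, rfl, rfl⟩]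
        refine le_trans ?_ (le_max_right _ _)
        exact add_le_add (hmono b ⟨_, h3⟩ ⟨_, h5⟩) (hmono c ⟨_, h5⟩ ⟨_, h4⟩))
    hn ⟨hs, rfl, fun _ _ _ => le_rfl⟩
  exact ⟨s', hrun, hidx, hS, hf, hmono, fun i j k => hG i i.2 j j.2 k k.2⟩

/-- Apply all rules to all triples. -/
def sweep : Prog :=
  .seq (forTriples (relax .P .P .P))
    (.seq (forTriples (relax .T .P .R)) (forTriples (relax .P .L .T)))

/-- The matrices dominate all derivations of depth at most `h`. -/
def Dominates (h : ℕ) (d : Data) : Prop :=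
  I.pathGrammar.Complete h fun v => d.mat n v.1 v.2.1 v.2.2

theorem sweep_runs {h : ℕ} {s : State} (hn : s.idx 0 = n) (hs : Sound I s.data)
    (hd : Dominates I h s.data) :
    ∃ s', Runs sweep (24 * (n + 1) ^ 3) s s' ∧ (∀ q < 3, s'.idx q = s.idx q) ∧
      Sound I s'.data ∧ s'.idx 6 = s.idx 6 ∧ Dominates I (h + 1) s'.data := by
  obtain ⟨s₁, hrun₁, hidx₁, hs₁, hf₁, hm₁, hr₁⟩ := relaxAll_runs I .trans hn hs
  obtain ⟨s₂, hrun₂, hidx₂, hs₂, hf₂, hm₂, hr₂⟩ :=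
    relaxAll_runs I .up ((hidx₁ 0 (by omega)).trans hn) hs₁
  obtain ⟨s₃, hrun₃, hidx₃, hs₃, hf₃, hm₃, hr₃⟩ :=
    relaxAll_runs I .down ((hidx₂ 0 (by omega)).trans ((hidx₁ 0 (by omega)).trans hn)) hs₂
  refine ⟨s₃, (hrun₁.seq (hrun₂.seq hrun₃)).mono (by omega),
    fun q hq => ((hidx₃ q hq).trans (hidx₂ q hq)).trans (hidx₁ q hq), hs₃,
    (hf₃.trans hf₂).trans hf₁, ?_⟩
  have hm₁₂ : ∀ a i j, s.data.mat n a i j ≤ s₂.data.mat n a i j :=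
    fun a i j => (hm₁ a i j).trans (hm₂ a i j)
  refine Grammar.Complete.succ hd (fun v => (hm₁₂ _ _ _).trans (hm₃ _ _ _)) ?_
  rintro ⟨a, i, j⟩ ⟨b, i', k⟩ ⟨c, k', j'⟩ ⟨hr, h₁, h₂, h₃⟩
  simp only at hr h₁ h₂ h₃ ⊢
  subst h₁ h₂ h₃
  cases hr with
  | trans => exact (hr₁ i j k).trans ((hm₂ _ _ _).trans (hm₃ _ _ _))
  | up => exact (add_le_add (hm₁ _ _ _) (hm₁ _ _ _)).trans ((hr₂ i j k).trans (hm₃ _ _ _))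
  | down => exact (add_le_add (hm₁₂ _ _ _) (hm₁₂ _ _ _)).trans (hr₃ i j k)

/-- Apply all rules `4 n ^ 2` times to all triples. -/
def iterateSweep : Prog :=
  forLoop 1 (forLoop 2 (.seq (.seq sweep sweep) (.seq sweep sweep)))

/-- Two nested loops of four sweeps give `4 n ^ 2` sweeps, one per label of the grammar, and each
raises the dominated depth by one. -/
theorem iterateSweep_runs {s : State} (hn : s.idx 0 = n) (hs : Sound I s.data)
    (hd : Dominates I 0 s.data) :
    ∃ s', Runs iterateSweep (100 * (n + 1) ^ 5) s s' ∧ s'.idx 0 = n ∧ Sound I s'.data ∧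
      s'.idx 6 = s.idx 6 ∧ Dominates I (n * n * 4) s'.data := by
  have hfour : ∀ (h : ℕ) (s : State), s.idx 0 = n → Sound I s.data → Dominates I h s.data →
      ∃ s', Runs (.seq (.seq sweep sweep) (.seq sweep sweep)) (96 * (n + 1) ^ 3) s s' ∧
        (∀ q < 3, s'.idx q = s.idx q) ∧ Sound I s'.data ∧ s'.idx 6 = s.idx 6 ∧
        Dominates I (h + 4) s'.data := by
    intro h s hn hs hd
    obtain ⟨s₁, hrun₁, hidx₁, hs₁, hf₁, hd₁⟩ := sweep_runs I hn hs hd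
    have hn₁ := (hidx₁ 0 (by omega)).trans hn
    obtain ⟨s₂, hrun₂, hidx₂, hs₂, hf₂, hd₂⟩ := sweep_runs I hn₁ hs₁ hd₁
    have hn₂ := (hidx₂ 0 (by omega)).trans hn₁
    obtain ⟨s₃, hrun₃, hidx₃, hs₃, hf₃, hd₃⟩ := sweep_runs I hn₂ hs₂ hd₂
    have hn₃ := (hidx₃ 0 (by omega)).trans hn₂
    obtain ⟨s₄, hrun₄, hidx₄, hs₄, hf₄, hd₄⟩ := sweep_runs I hn₃ hs₃ hd₃
    exact ⟨s₄, ((hrun₁.seq hrun₂).seq (hrun₃.seq hrun₄)).mono (by omega),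
      fun q hq => (hidx₄ q hq).trans ((hidx₃ q hq).trans ((hidx₂ q hq).trans (hidx₁ q hq))), hs₄,
      hf₄.trans (hf₃.trans (hf₂.trans hf₁)), hd₄⟩
  obtain ⟨s', hrun, hidx, hS, hf, hD⟩ := forLoop_rule (r := 1) (by omega) (by omega)
    (base := s.idx) (p := forLoop 2 (.seq (.seq sweep sweep) (.seq sweep sweep)))
    (T := (96 * (n + 1) ^ 3 + 2) * (n + 1))
    (J := fun i d => Sound I d ∧ d.flag = s.idx 6 ∧ Dominates I (i * n * 4) d)
    (fun s₁ hb₁ _ hJ₁ => by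
      have hn₁ : s₁.idx 0 = n := (hb₁ 0 (by omega)).trans hn
      obtain ⟨s', hrun, hidx, hS, hf, hD⟩ := forLoop_rule (r := 2) (by omega) (by omega)
        (base := s₁.idx) (p := .seq (.seq sweep sweep) (.seq sweep sweep))
        (T := 96 * (n + 1) ^ 3)
        (J := fun j d => Sound I d ∧ d.flag = s.idx 6 ∧
          Dominates I (s₁.idx 1 * n * 4 + j * 4) d)
        (fun s₂ hb₂ _ hJ₂ => by
          obtain ⟨s', hrun, hidx, hS, hf, hD⟩ :=
            hfour _ s₂ ((hb₂ 0 (by omega)).trans hn₁) hJ₂.1 hJ₂.2.2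
          refine ⟨s', hrun, hidx, hS, hf.trans hJ₂.2.1, ?_⟩
          rwa [Nat.succ_mul, ← add_assoc])
        (s := s₁) (fun _ _ => rfl) (by simpa using hJ₁)
      rw [hn₁] at hrun hD
      refine ⟨s', hrun, hidx, hS, hf, ?_⟩
      rwa [Nat.succ_mul, Nat.add_mul])
    (s := s) (fun _ _ => rfl) ⟨hs, rfl, by simpa using hd⟩
  rw [hn] at hrun hD
  refine ⟨s', hrun.mono ?_, (hidx 0 (by omega)).trans hn, hS, hf, hD⟩
  have h : 1 ≤ n + 1 := by omega
  generalize n + 1 = m at h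
  have h₁ : m ≤ m ^ 5 := Nat.le_self_pow (by norm_num) m
  have h₂ : m ^ 2 ≤ m ^ 5 := Nat.pow_le_pow_right h (by norm_num)
  calc ((96 * m ^ 3 + 2) * m + 2) * m = 96 * m ^ 5 + 2 * m ^ 2 + 2 * m := by ring
    _ ≤ 100 * m ^ 5 := by omega

/-! ## Initialization -/

/-- Set the entries `i`, `j` of the matrices to initial weights. -/
def initEntry : Prog :=
  .seq (.instr (.numNeg ⟨4, 3, 4⟩ ⟨2, 4, 3⟩))
    (.seq (.instr (.numMax ⟨4, 3, 4⟩ ⟨4, 3, 4⟩ ⟨0, 3, 4⟩))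
      (.seq (.instr (.numCopy ⟨5, 3, 4⟩ ⟨1, 3, 4⟩))
        (.seq (.instr (.numNeg ⟨6, 3, 4⟩ ⟨3, 4, 3⟩)) (.instr (.numBot ⟨7, 3, 4⟩)))))

theorem initEntry_runs (s : State) :
    ∃ s', Runs initEntry 5 s s' ∧ s'.idx = s.idx ∧
      ∀ q i j, s'.num q i j =
        if i = s.idx 3 ∧ j = s.idx 4 then
          if q = 4 then max (-s.num 2 j i) (s.num 0 i j)
          else if q = 5 then s.num 1 i j
          else if q = 6 then -s.num 3 j i
          else if q = 7 then ⊥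
          else s.num q i j
        else s.num q i j := by
  refine ⟨_, (Runs.instr _ _).seq ((Runs.instr _ _).seq ((Runs.instr _ _).seq
    ((Runs.instr _ _).seq (Runs.instr _ _)))), rfl, fun q i j => ?_⟩
  by_cases hij : i = s.idx 3 ∧ j = s.idx 4
  · obtain ⟨rfl, rfl⟩ := hij
    by_cases h4 : q = 4
    · subst h4; simp [Instr.run, State.setNum, State.get]
    by_cases h5 : q = 5
    · subst h5; simp [Instr.run, State.setNum, State.get]
    by_cases h6 : q = 6
    · subst h6; simp [Instr.run, State.setNum, State.get]
    by_cases h7 : q = 7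
    · subst h7; simp [Instr.run, State.setNum, State.get]
    simp [Instr.run, State.setNum, State.get, h4, h5, h6, h7]
  · simp [Instr.run, State.setNum, State.get, hij]

/-- `Pᵢᵢ := max Pᵢᵢ 0` and `Rᵢᵢ := max Rᵢᵢ 0` -/
def initDiag : Prog :=
  .seq (.instr (.numMax ⟨4, 3, 3⟩ ⟨4, 3, 3⟩ ⟨9, 3, 3⟩))
    (.instr (.numMax ⟨5, 3, 3⟩ ⟨5, 3, 3⟩ ⟨9, 3, 3⟩))

theorem initDiag_runs (s : State) :
    ∃ s', Runs initDiag 2 s s' ∧ s'.idx = s.idx ∧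
      ∀ q i j, s'.num q i j =
        if (q = 4 ∨ q = 5) ∧ i = s.idx 3 ∧ j = s.idx 3 then max (s.num q i j) (s.num 9 i j)
        else s.num q i j := by
  refine ⟨_, (Runs.instr _ _).seq (Runs.instr _ _), rfl, fun q i j => ?_⟩
  by_cases hij : i = s.idx 3 ∧ j = s.idx 3
  · obtain ⟨rfl, rfl⟩ := hij
    by_cases h4 : q = 4
    · subst h4; simp [Instr.run, State.setNum, State.get]
    by_cases h5 : q = 5
    · subst h5; simp [Instr.run, State.setNum, State.get]
    simp [Instr.run, State.setNum, h4, h5]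
  · simp [Instr.run, State.setNum, hij]

/-- Set the register `6` to `1` and the matrices to their initial weights. -/
def setup : Prog :=
  .seq (.seq (.instr (.idxZero 6)) (.instr (.idxSucc 6)))
    (.seq (forTriples initEntry) (forTriples initDiag))

theorem pad_apply (M : Fin n → Fin n → EReal) (i j : Fin n) : pad M i j = M i j := by
  simp [pad]

theorem setup_runs :
    ∃ s', Runs setup (21 * (n + 1) ^ 3) (input I) s' ∧ s'.idx 0 = n ∧ s'.idx 6 = 1 ∧
      Sound I s'.data ∧ Dominates I 0 s'.data := by
  obtain ⟨s₀, hs₀, hrun₀⟩ : ∃ s₀, s₀ = ((input I).setIdx 6 0).setIdx 6 1 ∧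
      Runs (.seq (.instr (.idxZero 6)) (.instr (.idxSucc 6))) 2 (input I) s₀ :=
    ⟨_, rfl, (Runs.instr _ _).seq (Runs.instr _ _)⟩
  have hn₀ : s₀.idx 0 = n := by simp [hs₀, State.setIdx, input]
  have hf₀ : s₀.idx 6 = 1 := by simp [hs₀, State.setIdx]
  have hnum₀ : s₀.num = (input I).num := by rw [hs₀]; rfl
  obtain ⟨s₁, hrun₁, hidx₁, ⟨hin₁, hf₁⟩, hG₁⟩ := forTriples_rule (n := n) (p := initEntry) (T := 5)
    (Inv := fun d => (∀ q, q < 4 ∨ q = 9 → d.num q = (input I).num q) ∧ d.flag = 1)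
    (G := fun i j _ d =>
      d.num 4 i j = max (-(input I).num 2 j i) ((input I).num 0 i j) ∧
      d.num 5 i j = (input I).num 1 i j ∧ d.num 6 i j = -(input I).num 3 j i ∧ d.num 7 i j = ⊥)
    (fun s _ _ _ hI => by
      obtain ⟨hin, hf⟩ := hI
      obtain ⟨s', hrun, hidx, hnum⟩ := initEntry_runs s
      simp only [State.data] at hin hf ⊢
      have h0 := hin 0 (by omega)
      have h1 := hin 1 (by omega)
      have h2 := hin 2 (by omega)
      have h3 := hin 3 (by omega)
      refine ⟨s', hrun, fun q _ => by rw [hidx], ⟨fun q hq => ?_, by rw [hidx]; exact hf⟩, ?_, ?_⟩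
      · funext i j
        rw [hnum, if_neg (show q ≠ 4 by omega), if_neg (show q ≠ 5 by omega),
          if_neg (show q ≠ 6 by omega), if_neg (show q ≠ 7 by omega), ite_self, hin q hq]
      · simp [hnum, h0, h1, h2, h3]
      -- Each entry is set once for every value of the idle third index; this is idempotent, as only
      -- the arrays `0`, …, `3` are read for the final values.
      · intro i j _ hG
        by_cases h : i = s.idx 3 ∧ j = s.idx 4
        · simp [hnum, h, h0, h1, h2, h3]
        · simpa only [hnum, if_neg h] using hG)
    hn₀ ⟨fun q _ => by rw [State.data, hnum₀], hf₀⟩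
  have hn₁ : s₁.idx 0 = n := (hidx₁ 0 (by omega)).trans hn₀
  have hP₁ : ∀ i j : Fin n, s₁.num 4 i j =
      max (-topToEReal (I.B 0 j i)) (botToEReal (I.A 0 i j)) := fun i j => by
    refine (hG₁ i i.2 j j.2 i i.2).1.trans ?_
    simp [input, pad_apply]
  have hR₁ : ∀ i j : Fin n, s₁.num 5 i j = botToEReal (I.A 1 i j) := fun i j => by
    refine (hG₁ i i.2 j j.2 i i.2).2.1.trans ?_
    simp [input, pad_apply]
  have hL₁ : ∀ i j : Fin n, s₁.num 6 i j = -topToEReal (I.B 1 j i) := fun i j => by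
    refine (hG₁ i i.2 j j.2 i i.2).2.2.1.trans ?_
    simp [input, pad_apply]
  have hT₁ : ∀ i j : Fin n, s₁.num 7 i j = ⊥ := fun i j => (hG₁ i i.2 j j.2 i i.2).2.2.2
  have hsound₁ : Sound I s₁.data := by
    refine ⟨fun i j => ?_, ?_⟩
    · rw [hin₁ 9 (by omega)]
      simp [input]
    · rintro ⟨a, i, j⟩
      cases a with
      | P =>
        change I.pathGrammar.Der _ (s₁.num 4 i j)
        rw [hP₁]
        rcases max_choice (-topToEReal (I.B 0 j i)) (botToEReal (I.A 0 i j)) with h | h <;> rw [h]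
        · exact .init (.upper i j)
        · exact .init (.lower i j)
      | R =>
        change I.pathGrammar.Der _ (s₁.num 5 i j)
        rw [hR₁]
        exact .init (.up i j)
      | L =>
        change I.pathGrammar.Der _ (s₁.num 6 i j)
        rw [hL₁]
        exact .init (.down i j)
      | T =>
        change I.pathGrammar.Der _ (s₁.num 7 i j)
        rw [hT₁]
        exact .init (.bot i j)
  obtain ⟨s₂, hrun₂, hidx₂, ⟨hsound₂, hf₂, hmono₂⟩, hG₂⟩ := forTriples_rule (n := n)
    (p := initDiag) (T := 2)
    (Inv := fun d => Sound I d ∧ d.flag = 1 ∧ ∀ q i j, s₁.num q i j ≤ d.num q i j)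
    (G := fun i _ _ d => 0 ≤ d.num 4 i i ∧ 0 ≤ d.num 5 i i)
    (fun s h3 _ _ hI => by
      obtain ⟨⟨hz, hS⟩, hf, hmono⟩ := hI
      obtain ⟨s', hrun, hidx, hnum⟩ := initDiag_runs s
      have hle : ∀ q i j, s.num q i j ≤ s'.num q i j := by
        intro q i j
        rw [hnum]
        split_ifs
        · exact le_max_left _ _
        · exact le_rfl
      have hz' : ∀ i j, s.num 9 i j = 0 := hz
      refine ⟨s', hrun, fun q _ => by rw [hidx], ⟨⟨fun i j => ?_, ?_⟩, ?_,
        fun q i j => (hmono q i j).trans (hle q i j)⟩, ?_,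
        fun i _ _ h => ⟨h.1.trans (hle _ _ _), h.2.trans (hle _ _ _)⟩⟩
      · change s'.num 9 i j = 0
        rw [hnum, if_neg (by omega), hz']
      · rintro ⟨a, i, j⟩
        change I.pathGrammar.Der _ (s'.num (code a) i j)
        rw [hnum]
        split_ifs with h
        · obtain ⟨ha, hi, hj⟩ := h
          obtain rfl : i = j := Fin.ext (hi.trans hj.symm)
          rw [hz']
          rcases max_choice (s.num (code a) i i) 0 with h | h <;> rw [h]
          · exact hS (a, i, i)
          · cases a with
            | P => exact .init (.refl i)
            | R => exact .init (.wait i)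
            | L => exact absurd ha (by decide)
            | T => exact absurd ha (by decide)
        · exact hS (a, i, j)
      · change s'.idx 6 = 1
        rw [hidx]
        exact hf
      · simp only [State.data, hnum]
        simp [hz'])
    hn₁ ⟨hsound₁, hf₁, fun _ _ _ => le_rfl⟩
  refine ⟨s₂, (hrun₀.seq (hrun₁.seq hrun₂)).mono ?_, (hidx₂ 0 (by omega)).trans hn₁, hf₂, hsound₂,
    Grammar.complete_zero ?_⟩
  · have : 0 < (n + 1) ^ 3 := by positivity
    omega
  · intro v w h
    cases h with
    | lower i j => exact ((le_max_right _ _).trans (hP₁ i j).ge).trans (hmono₂ 4 i j)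
    | upper i j => exact ((le_max_left _ _).trans (hP₁ i j).ge).trans (hmono₂ 4 i j)
    | refl i => exact (hG₂ i i.2 i i.2 i i.2).1
    | up i j => exact (hR₁ i j).ge.trans (hmono₂ 5 i j)
    | wait i => exact (hG₂ i i.2 i i.2 i i.2).2
    | down i j => exact (hL₁ i j).ge.trans (hmono₂ 6 i j)
    | bot i j => exact bot_le

/-! ## The decision programs -/

/-- Iterate the rules, and check whether the result is closed. -/
def closureProg : Prog :=
  .seq (.seq setup iterateSweep)
    (.seq (forTriples (check 4 .P .P))
      (.seq (forTriples (check 7 .P .R)) (forTriples (check 4 .L .T))))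

theorem card_label : Fintype.card (Kind × Fin n × Fin n) = n * n * 4 := by
  have : Fintype.card Kind = 4 := rfl
  rw [Fintype.card_prod, Fintype.card_prod, Fintype.card_fin, this, mul_comm]

/-- The constant is `21 + 100 + 3 * 9`, from setup, sweeps and the three closedness checks. -/
theorem closureProg_runs :
    ∃ s', Runs closureProg (148 * (n + 1) ^ 5) (input I) s' ∧ s'.idx 0 = n ∧ s'.idx 6 ≤ 1 ∧
      Sound I s'.data ∧ Dominates I (n * n * 4) s'.data ∧
      (s'.idx 6 = 1 ↔ CharMatrices.IsClosed (s'.data.mat n)) := by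
  obtain ⟨s₁, hrun₁, hn₁, hf₁, hs₁, hd₁⟩ := setup_runs I
  obtain ⟨s₂, hrun₂, hn₂, hs₂, hf₂, hd₂⟩ := iterateSweep_runs I hn₁ hs₁ hd₁
  obtain ⟨s₃, hrun₃, hn₃, hf₃, hnum₃, hc₃⟩ :=
    checkAll_runs (q := 4) (by omega) .P .P hn₂ (hf₂.trans hf₁).le
  obtain ⟨s₄, hrun₄, hn₄, hf₄, hnum₄, hc₄⟩ := checkAll_runs (q := 7) (by omega) .P .R hn₃ hf₃
  obtain ⟨s₅, hrun₅, hn₅, hf₅, hnum₅, hc₅⟩ := checkAll_runs (q := 4) (by omega) .L .T hn₄ hf₄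
  have hnum : ∀ q ≠ 8, s₅.num q = s₂.num q := fun q hq =>
    (hnum₅ q hq).trans ((hnum₄ q hq).trans (hnum₃ q hq))
  have hmat : s₅.data.mat n = s₂.data.mat n := by
    funext a i j
    exact congrFun₂ (hnum _ (code_lt a).ne) i j
  refine ⟨s₅, ((hrun₁.seq hrun₂).seq (hrun₃.seq (hrun₄.seq hrun₅))).mono ?_, hn₅, hf₅, ?_, ?_, ?_⟩
  · have : (n + 1) ^ 3 ≤ (n + 1) ^ 5 := Nat.pow_le_pow_right n.succ_pos (by norm_num)
    omega
  · refine ⟨fun i j => ?_, by rw [hmat]; exact hs₂.2⟩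
    exact (congrFun₂ (hnum 9 (by omega)) i j).trans (hs₂.1 i j)
  · unfold Dominates
    rw [hmat]
    exact hd₂
  · have hnum₃' : ∀ a, s₃.num (code a) = s₂.num (code a) := fun a => hnum₃ _ (code_lt a).ne
    have hnum₄' : ∀ a, s₄.num (code a) = s₂.num (code a) := fun a =>
      (hnum₄ _ (code_lt a).ne).trans (hnum₃' a)
    have h₃7 : s₃.num 7 = s₂.num 7 := hnum₃' .T
    have h₄4 : s₄.num 4 = s₂.num 4 := hnum₄' .P
    rw [hc₅, hc₄, hc₃, hmat, hnum₃', hnum₃', hnum₄', hnum₄', h₃7, h₄4]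
    constructor
    · rintro ⟨⟨⟨_, h₁⟩, h₂⟩, h₃⟩ a b c hr
      cases hr with
      | trans => exact h₁
      | up => exact h₂
      | down => exact h₃
    · exact fun h => ⟨⟨⟨hf₂.trans hf₁, h _ _ _ .trans⟩, h _ _ _ .up⟩, h _ _ _ .down⟩

/-- Decide consistency under loose initial conditions. -/
def looseProg : Prog :=
  .seq closureProg (.instr (.idxCopy 0 6))

theorem looseProg_decides :
    DecidesInTime looseProg (fun _ I => I.ConsistentLoose) fun n => 160 * (n + 1) ^ 5 := by
  intro n I
  obtain ⟨s, hrun, _, hf, hs, hd, hc⟩ := closureProg_runs I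
  obtain ⟨t, he, ht⟩ := hrun.seq (Runs.instr (.idxCopy 0 6) s)
  have hiff := CharMatrices.consistentLoose_iff_isClosed hs.2 hd card_label.le
  refine ⟨t, _, he, ht.trans ?_, fun hQ => ?_, fun hQ => ?_⟩
  · have : 0 < (n + 1) ^ 5 := by positivity
    change _ ≤ 160 * (n + 1) ^ 5
    omega
  · exact hc.2 (hiff.1 hQ)
  · have : s.idx 6 ≠ 1 := fun h => hQ (hiff.2 (hc.1 h))
    change s.idx 6 = 0
    omega

/-- Decide consistency under strict initial conditions. -/
def strictProg : Prog :=
  .seq (.seq closureProg (forTriples (check 9 .L .T))) (.instr (.idxCopy 0 6))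

/-- The array `9` serves as the zero matrix in the additional check of `L` and `T`. The resulting
criterion does not involve `t₀`, so one program serves all initial times. -/
theorem strictProg_decides (t₀ : ℝ) :
    DecidesInTime strictProg (fun _ I => I.ConsistentStrict t₀) fun n => 160 * (n + 1) ^ 5 := by
  intro n I
  obtain ⟨s, hrun, hn, hf, hs, hd, hc⟩ := closureProg_runs I
  obtain ⟨s', hrun', _, hf', _, hc'⟩ := checkAll_runs (q := 9) (by omega) .L .T hn hf
  obtain ⟨t, he, ht⟩ := (hrun.seq hrun').seq (Runs.instr (.idxCopy 0 6) s')
  have hz : ∀ i j, s.num 9 i j = 0 := hs.1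
  have hiff := CharMatrices.consistentStrict_iff_isClosed hs.2 hd card_label.le t₀
  simp only [hz] at hc'
  have hiff' : s'.idx 6 = 1 ↔ I.ConsistentStrict t₀ := by
    rw [hc', hc, hiff]
    rfl
  refine ⟨t, _, he, ht.trans ?_, fun hQ => hiff'.2 hQ, fun hQ => ?_⟩
  · have : 0 < (n + 1) ^ 5 := by positivity
    have : (n + 1) ^ 3 ≤ (n + 1) ^ 5 := Nat.pow_le_pow_right n.succ_pos (by norm_num)
    change _ ≤ 160 * (n + 1) ^ 5
    omega
  · have : s'.idx 6 ≠ 1 := fun h => hQ (hiff'.1 h)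
    change s'.idx 6 = 0
    omega

theorem isBigO_pow_five :
    (fun n : ℕ => ((160 * (n + 1) ^ 5 : ℕ) : ℝ)) =O[atTop] fun n : ℕ => (n : ℝ) ^ 5 := by
  -- The factor `2 ^ 5` comes from `n + 1 ≤ 2 * n` for `n ≥ 1`.
  refine IsBigO.of_bound (160 * 2 ^ 5) ?_
  filter_upwards [eventually_ge_atTop 1] with n hn
  have h : (1 : ℝ) ≤ n := by exact_mod_cast hn
  rw [Real.norm_of_nonneg (by positivity), Real.norm_of_nonneg (by positivity)]
  push_cast
  rw [mul_assoc, ← mul_pow]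
  gcongr
  linarith

end Machine

end PTimeEventGraph

end

/-! ### Graph criteria and complexity bounds combined -/

theorem mainTheorem7 :
    -- P-time event graphs with at most one initial token per place
    (∀ (n : ℕ) (P : Type*) [Fintype P] (N : PTimeEventGraph.PTEG P n),
      (N.ConsistentLoose ↔ ¬ N.charMatrices.looseGraph.HasInftyWeightPath) ∧
      ∀ t₀ : ℝ, (N.ConsistentStrict t₀ ↔ ¬ N.charMatrices.strictGraph.HasInftyWeightPath)) ∧
    -- arbitrary characteristic matrices
    (∀ (n : ℕ) (I : PTimeEventGraph.CharMatrices n),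
      (I.ConsistentLoose ↔ ¬ I.looseGraph.HasInftyWeightPath) ∧
      ∀ t₀ : ℝ, (I.ConsistentStrict t₀ ↔ ¬ I.strictGraph.HasInftyWeightPath)) ∧
    -- consistency under loose initial conditions is decided in time `O(n ^ 5)`
    (∃ (p : PTimeEventGraph.Machine.Prog) (T : ℕ → ℕ),
      (fun n : ℕ => (T n : ℝ)) =O[atTop] (fun n : ℕ => (n : ℝ) ^ 5) ∧
      PTimeEventGraph.Machine.DecidesInTime p (fun _ I => I.ConsistentLoose) T) ∧
    -- consistency under strict initial conditions is decided in time `O(n ^ 5)`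
    (∃ (p : PTimeEventGraph.Machine.Prog) (T : ℕ → ℕ),
      (fun n : ℕ => (T n : ℝ)) =O[atTop] (fun n : ℕ => (n : ℝ) ^ 5) ∧
      ∀ t₀ : ℝ,
        PTimeEventGraph.Machine.DecidesInTime p (fun _ I => I.ConsistentStrict t₀) T) := by
  refine ⟨fun n P _ N => ⟨?_, fun t₀ => ?_⟩, fun n I => ⟨?_, fun t₀ => ?_⟩,
    ⟨_, _, PTimeEventGraph.Machine.isBigO_pow_five, PTimeEventGraph.Machine.looseProg_decides⟩,
    ⟨_, _, PTimeEventGraph.Machine.isBigO_pow_five, PTimeEventGraph.Machine.strictProg_decides⟩⟩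
  · rw [← N.consistentLoose_charMatrices_iff]
    exact N.charMatrices.consistentLoose_iff_not_hasInftyWeightPath
  · rw [← N.consistentStrict_charMatrices_iff]
    exact N.charMatrices.consistentStrict_iff_not_hasInftyWeightPath t₀
  · exact I.consistentLoose_iff_not_hasInftyWeightPath
  · exact I.consistentStrict_iff_not_hasInftyWeightPath t₀
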